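/- Let $R$ and $C$ be finite sets of rows and columns, $|R|=m$, $|C|=n$, with positive weights $w_R(i)$ ($i\in R$) and $w_C(j)$ ($j\in C$), and let $1\le k\le\min(m,n)$. Let $Z\subseteq R\times C$ be a set of sites. A file is a row or a column; a cover of $Z$ is a set of files such that every site of $Z$ lies in one of them; a cover is optimal if it has the minimum number of files. There is an optimal cover of $Z$ that contains every row belonging to some optimal cover of $Z$ (the row-maximal optimal cover); let $r(Z)$ be the set of its rows. Let $I_k(Z)$ be the family of all sets $X\subseteq R$ of rows that are contained in a cover of $Z$ consisting of exactly $k-1$ files. Let $M$ be a random $R\times C$ matrix such that (almost surely) $M(i,j)=0$ for $(i,j)\in Z$; for $i\in r(Z)$ and $(i,j)\notin Z$, $M(i,j)$ is a fixed positive real number; and the entries $M(i,j)$ with $i\notin r(Z)$, $(i,j)\notin Z$ are independent, $M(i,j)$ being exponentially distributed with rate $w_R(i)w_C(j)$. A $k$-assignment is a set of $k$ sites, no two in the same row or column; its cost is the sum of the entries of $M$ at its sites, and it is optimal if its cost is minimum among all $k$-assignments. Let $\rho_k(M)$ be the random set of rows that contain a site of some optimal $k$-assignment. In the urn process on $R$,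 the balls $i\in R$ are drawn at independent times $T_i$, with $T_i$ exponentially distributed with rate $w_R(i)$, and $u_R(t)=\{i\in R: T_i\le t\}$ is the set of balls drawn by time $t\ge 0$. Let $\mathrm{exit}_R(I_k(Z))$ be the first set in this process that does not belong to $I_k(Z)$, that is, $u_R(\tau)$ with $\tau=\inf\{t\ge 0: u_R(t)\notin I_k(Z)\}$. Then, for every row $i_0\in R$ that contains no site of $Z$, $$\Pr(i_0\in\rho_k(M))=\Pr\bigl(i_0\in\mathrm{exit}_R(I_k(Z))\bigr).$$ -/

import Mathlib

open MeasureTheory ProbabilityTheory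

namespace RowParticipation

section Covers

variable {R C : Type*}

/-- A set of files (a file is a row `Sum.inl i` or a column `Sum.inr j`) covers the set `Z` of
sites if every site of `Z` lies in one of the files. -/
def IsCover (Z : Set (R × C)) (F : Finset (R ⊕ C)) : Prop :=
  ∀ p ∈ Z, Sum.inl p.1 ∈ F ∨ Sum.inr p.2 ∈ F

/-- A cover with the minimum number of files among all covers. -/
def IsOptimalCover (Z : Set (R × C)) (F : Finset (R ⊕ C)) : Prop :=
  IsCover Z F ∧ ∀ G : Finset (R ⊕ C), IsCover Z G → F.card ≤ G.card

/-- An optimal cover that contains every row belonging to some optimal cover. -/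
def IsRowMaximalOptimalCover (Z : Set (R × C)) (F : Finset (R ⊕ C)) : Prop :=
  IsOptimalCover Z F ∧
    ∀ G : Finset (R ⊕ C), IsOptimalCover Z G → ∀ i : R, Sum.inl i ∈ G → Sum.inl i ∈ F

theorem IsOptimalCover.exists_sup [DecidableEq R] [DecidableEq C] {Z : Set (R × C)}
    {F G : Finset (R ⊕ C)} (hF : IsOptimalCover Z F) (hG : IsOptimalCover Z G) :
    IsOptimalCover Z ((F.toLeft ∪ G.toLeft).disjSum (F.toRight ∩ G.toRight)) := by
  have h1 : IsCover Z ((F.toLeft ∪ G.toLeft).disjSum (F.toRight ∩ G.toRight)) := by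
    intro p hp
    have := hF.1 p hp
    have := hG.1 p hp
    simp only [Finset.inl_mem_disjSum, Finset.inr_mem_disjSum, Finset.mem_union,
      Finset.mem_inter, Finset.mem_toLeft, Finset.mem_toRight]
    tauto
  have h2 : IsCover Z ((F.toLeft ∩ G.toLeft).disjSum (F.toRight ∪ G.toRight)) := by
    intro p hp
    have := hF.1 p hp
    have := hG.1 p hp
    simp only [Finset.inl_mem_disjSum, Finset.inr_mem_disjSum, Finset.mem_union,
      Finset.mem_inter, Finset.mem_toLeft, Finset.mem_toRight]
    tauto
  have h3 := hF.2 _ h2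
  have h4 := Finset.card_union_add_card_inter F.toLeft G.toLeft
  have h5 := Finset.card_union_add_card_inter F.toRight G.toRight
  have h6 := F.card_toLeft_add_card_toRight
  have h7 := G.card_toLeft_add_card_toRight
  refine ⟨h1, fun H hH => ?_⟩
  have h8 := hG.2 H hH
  rw [Finset.card_disjSum] at h3 ⊢
  omega

/-- The row-maximal optimal cover exists. -/
theorem exists_rowMaximalOptimalCover [Fintype R] [Fintype C] (Z : Set (R × C)) :
    ∃ F : Finset (R ⊕ C), IsRowMaximalOptimalCover Z F := by
  classical
  have h0 : IsCover Z (Finset.univ : Finset (R ⊕ C)) := fun p _ => by simp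
  obtain ⟨F0, hF0, hmin⟩ := Finset.exists_min_image
    (Finset.univ.filter fun F : Finset (R ⊕ C) => IsCover Z F) Finset.card
    ⟨Finset.univ, by simpa using h0⟩
  have hopt : IsOptimalCover Z F0 :=
    ⟨by simpa using hF0, fun G hG => hmin G (by simpa using hG)⟩
  obtain ⟨F, hF, hmax⟩ := Finset.exists_max_image
    (Finset.univ.filter fun F : Finset (R ⊕ C) => IsOptimalCover Z F) (fun F => F.toLeft.card)
    ⟨F0, by simpa using hopt⟩
  have hF' : IsOptimalCover Z F := by simpa using hF
  refine ⟨F, hF', fun G hG i hi => ?_⟩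
  have h1 := hmax _ (Finset.mem_filter.2 ⟨Finset.mem_univ _, hF'.exists_sup hG⟩)
  rw [Finset.toLeft_disjSum] at h1
  have h2 := Finset.eq_of_subset_of_card_le (Finset.subset_union_left (s₂ := G.toLeft)) h1
  have h3 : i ∈ F.toLeft ∪ G.toLeft := Finset.mem_union_right _ (Finset.mem_toLeft.2 hi)
  rw [← h2] at h3
  exact Finset.mem_toLeft.1 h3

/-- The row-maximal optimal cover of `Z`. -/
noncomputable def rowMaximalOptimalCover [Fintype R] [Fintype C] (Z : Set (R × C)) :
    Finset (R ⊕ C) :=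
  (exists_rowMaximalOptimalCover Z).choose

/-- `r(Z)`: the set of rows in the row-maximal optimal cover of `Z`. -/
def rowMaximalRows [Fintype R] [Fintype C] (Z : Set (R × C)) : Set R :=
  {i | Sum.inl i ∈ rowMaximalOptimalCover Z}

/-- `I_k(Z)`, for `k ≥ 1`: the family of those sets of rows that are partial `k-1`-covers of `Z`,
i.e. contained in a cover of `Z` consisting of exactly `k - 1` files. -/
def rowIdeal (k : ℕ) (Z : Set (R × C)) : Set (Set R) :=
  {X | ∃ F : Finset (R ⊕ C), IsCover Z F ∧ F.card + 1 = k ∧ ∀ i ∈ X, Sum.inl i ∈ F}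

end Covers

section Assignments

variable {R C : Type*}

/-- A `k`-assignment: `k` sites, no two of which are in the same row or column. -/
def IsAssignment (k : ℕ) (π : Finset (R × C)) : Prop :=
  π.card = k ∧ ∀ p ∈ π, ∀ q ∈ π, p ≠ q → p.1 ≠ q.1 ∧ p.2 ≠ q.2

/-- The cost of a set of sites in the matrix `A`. -/
def cost (A : Matrix R C ℝ) (π : Finset (R × C)) : ℝ :=
  ∑ p ∈ π, A p.1 p.2

/-- A `k`-assignment of minimum cost. -/
def IsOptimalAssignment (k : ℕ) (A : Matrix R C ℝ) (π : Finset (R × C)) : Prop :=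
  IsAssignment k π ∧ ∀ π' : Finset (R × C), IsAssignment k π' → cost A π ≤ cost A π'

/-- `ρ_k(A)`: the set of rows that intersect some optimal `k`-assignment in `A`. -/
def participatingRows (k : ℕ) (A : Matrix R C ℝ) : Set R :=
  {i | ∃ π : Finset (R × C), IsOptimalAssignment k A π ∧ ∃ p ∈ π, p.1 = i}

end Assignments

section Urn

variable {R : Type*}

/-- The joint law of the times at which the balls leave the urn: independent, and exponential of
rate `w i` for the ball `i`. -/
noncomputable def urnMeasure [Fintype R] (w : R → ℝ) : Measure (R → ℝ) :=
  Measure.pi fun i => expMeasure (w i)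

/-- The set of balls drawn at time `t`, when ball `i` is drawn at time `T i`. -/
def urnState (T : R → ℝ) (t : ℝ) : Set R :=
  {i | T i ≤ t}

/-- The time at which the urn process leaves the family `I`. -/
noncomputable def exitTime (I : Set (Set R)) (T : R → ℝ) : ℝ :=
  sInf {t : ℝ | 0 ≤ t ∧ urnState T t ∉ I}

/-- The first set in the urn process that does not belong to `I`; as `urnState T` is
right-continuous, it is the state at the exit time. -/
noncomputable def exitSet (I : Set (Set R)) (T : R → ℝ) : Set R :=
  urnState T (exitTime I T)

end Urn

end RowParticipation

set_option linter.unusedSectionVars false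
-- Both sides are the probability that `i₀` is chosen in one and the same weighted random sequence
-- of rows, `selectionProb`.
--
-- The sequence moves through covers `(S, c)` of `Z` by rows and columns (`greedyState`). It starts
-- at the row-maximal optimal cover. Choosing a row outside `S` puts that row into `S` and passes to
-- the row-maximal optimal cover of the sites outside the enlarged `S`. Each choice raises `|S| +
-- |c|` by one (`card_greedyState`), and a row without sites of `Z` enters `S` only by being chosen.
-- If `k` is at most the optimal cover number, no choice is made and both probabilities are 0.
--
-- Urn: before the last choice `(S, c)` is a cover with `k - 1` files, so the sets drawn so far are
-- in the ideal. Afterwards every cover containing all chosen rows has at least `k` files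
-- (`card_greedyState_le_card`). The urn therefore exits when the last chosen ball is drawn, and
-- `i₀` is drawn by then exactly if it was chosen.
--
-- Matrix: choose the row `i` minimizing, together with a column `j`, the entry `M i j` plus the
-- cost of assigning `S` outside `insert j c`. An exchange argument in a relaxed matrix shows that
-- this yields a minimum assignment (`IsGreedy.partialCost_le`), so chosen rows participate. The
-- entries of an unchosen zero-free row can be lowered a little without affecting the choices or the
-- minimum, so that row lies in no optimal assignment.
--
-- Law of the choices: given the entries in the rows of `S`, having reached the state means only
-- that the other random entries exceed bounds depending on the column alone (`event_eq_of_agree`).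
-- With rates `w i * b j`, the row attaining the next minimum is then distributed proportionally to
-- `w` (`measure_rowEvent_mul`). The urn is the case of a single column.
namespace RowParticipation

/-! ### Recombining two matchings. -/

section Exchange

variable {R C : Type*}

/-- A multiset of sites, no two of which share a row or a column. -/
def IsMatching (σ : Multiset (R × C)) : Prop :=
  (σ.map Prod.fst).Nodup ∧ (σ.map Prod.snd).Nodup

theorem isMatching_cons {p : R × C} {σ : Multiset (R × C)} :
    IsMatching (p ::ₘ σ) ↔
      p.1 ∉ σ.map Prod.fst ∧ p.2 ∉ σ.map Prod.snd ∧ IsMatching σ := by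
  simp only [IsMatching, Multiset.map_cons, Multiset.nodup_cons]
  tauto

theorem IsMatching.nodup {σ : Multiset (R × C)} (h : IsMatching σ) : σ.Nodup :=
  Multiset.Nodup.of_map _ h.1

theorem exists_cons_of_mem_rows {σ : Multiset (R × C)} {i : R} (h : i ∈ σ.map Prod.fst) :
    ∃ j σ₁, σ = (i, j) ::ₘ σ₁ := by
  obtain ⟨⟨i', j⟩, hp, rfl⟩ := Multiset.mem_map.1 h
  obtain ⟨σ₁, h⟩ := Multiset.exists_cons_of_mem hp
  exact ⟨j, σ₁, h⟩

theorem exists_cons_of_mem_cols {σ : Multiset (R × C)} {j : C} (h : j ∈ σ.map Prod.snd) :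
    ∃ i σ₁, σ = (i, j) ::ₘ σ₁ := by
  obtain ⟨⟨i', j⟩, hp, rfl⟩ := Multiset.mem_map.1 h
  obtain ⟨σ₁, h⟩ := Multiset.exists_cons_of_mem hp
  exact ⟨i', σ₁, h⟩

/-- Here and in the next lemmas `σ' + π'` redistributes `σ + π`, so the total multiplicity of a row
or column is fixed. The cases are multiplicity 0, at most 1, at least 2, and at least 1. -/
theorem notMem_map_of_add_eq {α β : Type*} (f : α → β) {σ π σ' π' : Multiset α} {b : β}
    (h : σ' + π' = σ + π) (h1 : b ∉ σ.map f) (h2 : b ∉ π.map f) :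
    b ∉ σ'.map f ∧ b ∉ π'.map f := by
  have h3 : b ∉ (σ' + π').map f := by
    rw [h, Multiset.map_add, Multiset.mem_add]; tauto
  rw [Multiset.map_add, Multiset.mem_add] at h3
  tauto

theorem notMem_map_right_of_add_eq {α β : Type*} (f : α → β) {σ π σ' π' : Multiset α} {b : β}
    (h : σ' + π' = σ + π) (h1 : b ∉ σ.map f) (h2 : (π.map f).Nodup) (h3 : b ∈ σ'.map f) :
    b ∉ π'.map f := by
  classical
  intro h4
  have h5 := congrArg (fun s => (s.map f).count b) h
  simp only [Multiset.map_add, Multiset.count_add] at h5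
  rw [Multiset.count_eq_zero.2 h1] at h5
  have := Multiset.nodup_iff_count_le_one.1 h2 b
  have := Multiset.count_pos.2 h3
  have := Multiset.count_pos.2 h4
  omega

theorem mem_map_right_of_add_eq {α β : Type*} (f : α → β) {σ π σ' π' : Multiset α} {b : β}
    (h : σ' + π' = σ + π) (h1 : b ∈ σ.map f) (h2 : b ∈ π.map f) (h3 : (σ'.map f).Nodup) :
    b ∈ π'.map f := by
  classical
  have h5 := congrArg (fun s => (s.map f).count b) h
  simp only [Multiset.map_add, Multiset.count_add] at h5
  have := Multiset.nodup_iff_count_le_one.1 h3 b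
  have := Multiset.count_pos.2 h1
  have := Multiset.count_pos.2 h2
  exact Multiset.count_pos.1 (by omega)

theorem mem_map_right_of_add_eq_of_notMem {α β : Type*} (f : α → β) {σ π σ' π' : Multiset α}
    {b : β} (h : σ' + π' = σ + π) (h1 : b ∈ (σ + π).map f) (h3 : b ∉ σ'.map f) :
    b ∈ π'.map f := by
  rw [← h, Multiset.map_add, Multiset.mem_add] at h1
  tauto

theorem exists_mem_notMem_of_card_lt {α : Type*} {s t : Multiset α} (ht : t.Nodup)
    (h : s.card < t.card) : ∃ a ∈ t, a ∉ s := by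
  by_contra! hc
  have := Multiset.card_le_card ((Multiset.le_iff_subset ht).2 hc)
  omega

/-- Two matchings of different sizes can be recombined so that the smaller one gains a site. -/
theorem exists_augment (σ : Multiset (R × C)) : ∀ π : Multiset (R × C), IsMatching σ →
    IsMatching π → σ.card < π.card → ∃ σ' π' : Multiset (R × C), IsMatching σ' ∧ IsMatching π' ∧
      σ' + π' = σ + π ∧ σ'.card = σ.card + 1 := by
  induction hn : σ.card generalizing σ with
  | zero =>
    intro π hσ hπ hlt
    obtain rfl := Multiset.card_eq_zero.1 hn
    obtain ⟨p, hp⟩ := Multiset.card_pos_iff_exists_mem.1 hlt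
    obtain ⟨π₁, rfl⟩ := Multiset.exists_cons_of_mem hp
    refine ⟨{p}, π₁, ?_, (isMatching_cons.1 hπ).2.2, by simp, by simp⟩
    simp [IsMatching]
  | succ n ih =>
    intro π hσ hπ hlt
    obtain ⟨u, huπ, huσ⟩ := exists_mem_notMem_of_card_lt hπ.1
      (s := σ.map Prod.fst) (by simpa [hn] using hlt)
    obtain ⟨j, π₁, rfl⟩ := exists_cons_of_mem_rows huπ
    obtain ⟨hπ1, hπ2, hπ3⟩ := isMatching_cons.1 hπ
    by_cases hj : j ∈ σ.map Prod.snd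
    -- Follow the alternating path: set both sites of column `j` aside and recombine the rest. Row
    -- `i` occurs at most once in the rest, so `(i, j)` fits into one of the two parts, and `(u, j)`
    -- goes into the other.
    · obtain ⟨i, σ₁, rfl⟩ := exists_cons_of_mem_cols hj
      obtain ⟨hσ1, hσ2, hσ3⟩ := isMatching_cons.1 hσ
      dsimp only at *
      obtain ⟨σ', π', h1, h2, h3, h4⟩ := ih σ₁ (by simpa using hn) π₁ hσ3 hπ3
        (by simp at hlt hn; omega)
      have hu : u ∉ σ₁.map Prod.fst := fun h => huσ (by
        rw [Multiset.map_cons]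
        exact Multiset.mem_cons_of_mem h)
      have hu' := notMem_map_of_add_eq Prod.fst h3 hu hπ1
      have hj' := notMem_map_of_add_eq Prod.snd h3 hσ2 hπ2
      by_cases hi : i ∈ σ'.map Prod.fst
      · have hi' := notMem_map_right_of_add_eq Prod.fst h3 hσ1 hπ3.1 hi
        refine ⟨(u, j) ::ₘ σ', (i, j) ::ₘ π', isMatching_cons.2 ⟨hu'.1, hj'.1, h1⟩,
          isMatching_cons.2 ⟨hi', hj'.2, h2⟩, ?_, by simp [h4]⟩
        simp only [Multiset.cons_add, Multiset.add_cons, h3]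
        exact Multiset.cons_swap _ _ _
      · refine ⟨(i, j) ::ₘ σ', (u, j) ::ₘ π', isMatching_cons.2 ⟨hi, hj'.1, h1⟩,
          isMatching_cons.2 ⟨hu'.2, hj'.2, h2⟩, ?_, by simp [h4]⟩
        simp only [Multiset.cons_add, Multiset.add_cons, h3]
    · exact ⟨(u, j) ::ₘ σ, π₁, isMatching_cons.2 ⟨huσ, hj, hσ⟩, hπ3, by simp, by simp [hn]⟩

/-- If a row `v` meets the smaller one of two matchings but not the larger one, then the two can be
recombined without changing their sizes so that `v` only meets the larger one. -/
theorem exists_exchange (σ : Multiset (R × C)) : ∀ (π : Multiset (R × C)) (v : R), IsMatching σ →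
    IsMatching π → σ.card < π.card → v ∈ σ.map Prod.fst → v ∉ π.map Prod.fst →
    ∃ σ' π' : Multiset (R × C), IsMatching σ' ∧ IsMatching π' ∧
      σ' + π' = σ + π ∧ σ'.card = σ.card ∧ v ∉ σ'.map Prod.fst := by
  induction hn : σ.card generalizing σ with
  | zero =>
    intro π v _ _ _ hv
    obtain rfl := Multiset.card_eq_zero.1 hn
    simp at hv
  | succ n ih =>
    intro π v hσ hπ hlt hvσ hvπ
    obtain ⟨j, σ₁, rfl⟩ := exists_cons_of_mem_rows hvσ
    obtain ⟨hσ1, hσ2, hσ3⟩ := isMatching_cons.1 hσ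
    dsimp only at *
    have hn1 : σ₁.card = n := by simpa using hn
    -- If `π` has a site `(i, j)`, it trades places with `(v, j)`; when `i` already meets `σ₁`,
    -- induction with `i` in place of `v` first frees it. If `π` does not use column `j`, then `(v,
    -- j)` moves to the larger part and augmenting `σ₁` makes up for the loss.
    by_cases hj : j ∈ π.map Prod.snd
    · obtain ⟨i, π₁, rfl⟩ := exists_cons_of_mem_cols hj
      obtain ⟨hπ1, hπ2, hπ3⟩ := isMatching_cons.1 hπ
      dsimp only at *
      simp only [Multiset.map_cons, Multiset.mem_cons, not_or] at hvπ
      obtain ⟨hvi, hvπ⟩ := hvπ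
      by_cases hi : i ∈ σ₁.map Prod.fst
      · obtain ⟨σ', π', h1, h2, h3, h4, h5⟩ := ih σ₁ hn1 π₁ i hσ3 hπ3
          (by simp at hlt; omega) hi hπ1
        have hv' := notMem_map_of_add_eq Prod.fst h3 hσ1 hvπ
        have hj' := notMem_map_of_add_eq Prod.snd h3 hσ2 hπ2
        refine ⟨(i, j) ::ₘ σ', (v, j) ::ₘ π', isMatching_cons.2 ⟨h5, hj'.1, h1⟩,
          isMatching_cons.2 ⟨hv'.2, hj'.2, h2⟩, ?_, by simp [h4], ?_⟩
        · simp only [Multiset.cons_add, Multiset.add_cons, h3]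
          exact Multiset.cons_swap _ _ _
        · simp only [Multiset.map_cons, Multiset.mem_cons, not_or]
          exact ⟨hvi, hv'.1⟩
      · refine ⟨(i, j) ::ₘ σ₁, (v, j) ::ₘ π₁, isMatching_cons.2 ⟨hi, hσ2, hσ3⟩,
          isMatching_cons.2 ⟨hvπ, hπ2, hπ3⟩, ?_, by simp [hn1], ?_⟩
        · simp only [Multiset.cons_add, Multiset.add_cons]
          exact Multiset.cons_swap _ _ _
        · simp only [Multiset.map_cons, Multiset.mem_cons, not_or]
          exact ⟨hvi, hσ1⟩
    · obtain ⟨σ', π', h1, h2, h3, h4⟩ := exists_augment σ₁ π hσ3 hπ (by omega)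
      have hv' := notMem_map_of_add_eq Prod.fst h3 hσ1 hvπ
      have hj' := notMem_map_of_add_eq Prod.snd h3 hσ2 hj
      exact ⟨σ', (v, j) ::ₘ π', h1, isMatching_cons.2 ⟨hv'.2, hj'.2, h2⟩, by simp [h3],
        by omega, hv'.1⟩

end Exchange

end RowParticipation
namespace RowParticipation

/-! ### Cheapest assignments with one more site. -/

section Augment

variable {R C : Type*}

/-- The cost of a multiset of sites. -/
def mcost (A : R → C → ℝ) (τ : Multiset (R × C)) : ℝ := (τ.map fun p => A p.1 p.2).sum

theorem mcost_cons (A : R → C → ℝ) (p : R × C) (τ : Multiset (R × C)) :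
    mcost A (p ::ₘ τ) = A p.1 p.2 + mcost A τ := by simp [mcost]

theorem mcost_add (A : R → C → ℝ) (σ τ : Multiset (R × C)) :
    mcost A (σ + τ) = mcost A σ + mcost A τ := by simp [mcost]

theorem mcost_nonneg {A : R → C → ℝ} (hA : ∀ i j, 0 ≤ A i j) (τ : Multiset (R × C)) :
    0 ≤ mcost A τ := by
  refine Multiset.sum_nonneg fun x hx => ?_
  obtain ⟨p, -, rfl⟩ := Multiset.mem_map.1 hx
  exact hA _ _

theorem mcost_mono {A B : R → C → ℝ} (h : ∀ i j, A i j ≤ B i j) (τ : Multiset (R × C)) :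
    mcost A τ ≤ mcost B τ :=
  Multiset.sum_map_le_sum_map _ _ fun _ _ => h _ _

/-- The matching that assigns the columns `f i` to the rows `i ∈ S` and the rows `g j` to the
columns `j ∈ c`. -/
def graphMatching (S : Finset R) (c : Finset C) (f : R → C) (g : C → R) : Multiset (R × C) :=
  S.val.map (fun i => (i, f i)) + c.val.map fun j => (g j, j)

theorem isMatching_graphMatching {S : Finset R} {c : Finset C} {f : R → C} {g : C → R}
    (hf : Set.InjOn f S) (hfc : ∀ i ∈ S, f i ∉ c) (hg : Set.InjOn g c) (hgS : ∀ j ∈ c, g j ∉ S) :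
    IsMatching (graphMatching S c f g) := by
  constructor
  · simp only [graphMatching, Multiset.map_add, Multiset.map_map, Function.comp_def,
      Multiset.map_id']
    refine Multiset.nodup_add.2 ⟨S.nodup, c.nodup.map_on hg, ?_⟩
    rw [Multiset.disjoint_left]
    intro i hi hi'
    obtain ⟨j, hj, rfl⟩ := Multiset.mem_map.1 hi'
    exact hgS j hj hi
  · simp only [graphMatching, Multiset.map_add, Multiset.map_map, Function.comp_def,
      Multiset.map_id']
    refine Multiset.nodup_add.2 ⟨S.nodup.map_on hf, c.nodup, ?_⟩
    rw [Multiset.disjoint_left]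
    intro j hj hj'
    obtain ⟨i, hi, rfl⟩ := Multiset.mem_map.1 hj
    exact hfc i hi hj'

theorem card_graphMatching (S : Finset R) (c : Finset C) (f : R → C) (g : C → R) :
    (graphMatching S c f g).card = S.card + c.card := by
  simp [graphMatching]

theorem mcost_graphMatching (A : R → C → ℝ) (S : Finset R) (c : Finset C) (f : R → C) (g : C → R) :
    mcost A (graphMatching S c f g) = ∑ i ∈ S, A i (f i) + ∑ j ∈ c, A (g j) j := by
  simp only [graphMatching, mcost, Multiset.map_add, Multiset.sum_add, Multiset.map_map,
    Function.comp_def]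
  rfl

/-- A matching one larger than `S.card + c.card` that meets all rows of `S`, and avoids `S ×ˢ c`,
has a site outside the rows of `S` and the columns of `c`. -/
theorem exists_split_matching [Nonempty C] {S : Finset R} {c : Finset C} {τ : Multiset (R × C)}
    (hτ : IsMatching τ) (hcard : τ.card = S.card + c.card + 1)
    (hS : ∀ s ∈ S, s ∈ τ.map Prod.fst) (hSc : ∀ p ∈ τ, p.1 ∈ S → p.2 ∉ c) :
    ∃ (f : R → C) (r : R) (y : C) (π : Multiset (R × C)),
      τ = (r, y) ::ₘ (S.val.map (fun i => (i, f i)) + π) ∧ Set.InjOn f S ∧ r ∉ S ∧ y ∉ c ∧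
      ∀ i ∈ S, f i ∉ c ∧ f i ≠ y := by
  classical
  have h1 : ∀ s : R, ∃ j : C, s ∈ S → (s, j) ∈ τ := by
    intro s
    by_cases hs : s ∈ S
    · obtain ⟨⟨_, j⟩, hp, rfl⟩ := Multiset.mem_map.1 (hS s hs)
      exact ⟨j, fun _ => hp⟩
    · exact ⟨Classical.arbitrary C, fun h => absurd h hs⟩
  choose f hf using h1
  have h2 : S.val.map (fun i => (i, f i)) ≤ τ := by
    refine (Multiset.le_iff_subset (S.nodup.map fun a b h => (Prod.ext_iff.1 h).1)).2 ?_
    intro p hp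
    obtain ⟨i, hi, rfl⟩ := Multiset.mem_map.1 hp
    exact hf i hi
  obtain ⟨π, rfl⟩ := Multiset.le_iff_exists_add.1 h2
  have h3 := hτ
  simp only [IsMatching, Multiset.map_add, Multiset.map_map, Function.comp_def,
    Multiset.map_id', Multiset.nodup_add, Multiset.disjoint_left] at h3
  obtain ⟨⟨-, -, h4⟩, ⟨h5, h6, h7⟩⟩ := h3
  -- The sites in rows outside `S` number `c.card + 1`, too many for the columns of `c`.
  obtain ⟨y, hy, hyc⟩ := exists_mem_notMem_of_card_lt (s := c.val) h6 (by
    simp at hcard ⊢; omega)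
  obtain ⟨r, π₁, rfl⟩ := exists_cons_of_mem_cols hy
  refine ⟨f, r, y, π₁, by simp, Multiset.inj_on_of_nodup_map h5, ?_, hyc, fun i hi => ⟨?_, ?_⟩⟩
  · intro hr
    exact h4 hr (by simp)
  · exact hSc _ (hf i hi) hi
  · rintro rfl
    exact h7 (Multiset.mem_map.2 ⟨i, hi, rfl⟩) (by simp)

variable [Infinite R]

/-- Suppose that all rows outside the finite set `S` carry the same entries `a`, which vanish on
the columns in `c`. If a cheapest assignment of size `S.card + c.card` consists of an assignment of
the rows of `S` outside `c`, together with zeros in `c`, then a cheapest assignment with one more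
site arises from such an assignment by adding one site outside of `S` and `c`. -/
theorem le_mcost_of_augment [Finite C] [Nonempty C] {S : Finset R} {c : Finset C}
    {A : R → C → ℝ} {a : C → ℝ} {D Y : ℝ} (hA : ∀ i j, 0 ≤ A i j) (ha : ∀ i ∉ S, ∀ j, A i j = a j)
    (hac : ∀ j ∈ c, a j = 0)
    (hD : ∀ σ, IsMatching σ → σ.card = S.card + c.card → D ≤ mcost A σ)
    (f : R → C) (hf : Set.InjOn f S) (hfc : ∀ i ∈ S, f i ∉ c) (hfD : ∑ i ∈ S, A i (f i) ≤ D)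
    (hY : ∀ j ∉ c, ∀ f : R → C, Set.InjOn f S → (∀ i ∈ S, f i ∉ c ∧ f i ≠ j) →
      Y ≤ a j + ∑ i ∈ S, A i (f i))
    (τ : Multiset (R × C)) (hτ : IsMatching τ) (hcard : τ.card = S.card + c.card + 1) :
    Y ≤ mcost A τ := by
  classical
  -- Infinitely many rows lie outside `S`, so the columns of `c` can be given distinct rows at cost
  -- zero. This completes `f` to a reference matching `σ` of cost at most `D`.
  obtain ⟨g, hg, hgS⟩ : ∃ g : C → R, Set.InjOn g c ∧ ∀ j ∈ c, g j ∉ S := by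
    have : Infinite {i // i ∉ S} := (S.finite_toSet.infinite_compl).to_subtype
    obtain ⟨n, ⟨e⟩⟩ := Finite.exists_equiv_fin C
    let e' := (Infinite.natEmbedding {i // i ∉ S})
    exact ⟨fun j => e' (e j), fun x _ y _ h =>
      e.injective (Fin.ext (e'.injective (Subtype.ext h))), fun j _ => (e' _).2⟩
  set σ := graphMatching S c f g with hσdef
  have hσ : IsMatching σ := isMatching_graphMatching hf hfc hg hgS
  have hσc : σ.card = S.card + c.card := card_graphMatching S c f g
  have hσD : mcost A σ ≤ D := by
    rw [hσdef, mcost_graphMatching, Finset.sum_eq_zero (s := c), add_zero]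
    · exact hfD
    · intro j hj
      rw [ha _ (hgS j hj), hac j hj]
  have hσS : ∀ s ∈ S, s ∈ σ.map Prod.fst := by
    intro s hs
    simp only [hσdef, graphMatching, Multiset.map_add, Multiset.map_map, Function.comp_def,
      Multiset.map_id', Multiset.mem_add]
    exact Or.inl hs
  let bad : R × C → Prop := fun p => p.1 ∈ S ∧ p.2 ∈ c
  have hσbad : σ.countP bad = 0 := by
    rw [Multiset.countP_eq_zero]
    intro p hp hb
    simp only [hσdef, graphMatching, Multiset.mem_add, Multiset.mem_map] at hp
    rcases hp with ⟨i, hi, rfl⟩ | ⟨j, hj, rfl⟩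
    · exact hfc i hi hb.2
    · exact hgS j hj hb.1
  -- Exchange a missing row `s` with `σ`. As `σ'` has the size of `σ`, it costs at least `D`, so
  -- `τ'` costs no more than `τ`. Since `σ` has no bad site, `τ'` has no more than `τ`; and a row of
  -- `S` that meets both `σ` and `τ` occurs twice, hence still meets `τ'`.
  have key : ∀ τ : Multiset (R × C), IsMatching τ → τ.card = S.card + c.card + 1 →
      ∀ s ∈ S, s ∉ τ.map Prod.fst → ∃ τ' : Multiset (R × C), IsMatching τ' ∧
        τ'.card = S.card + c.card + 1 ∧ mcost A τ' ≤ mcost A τ ∧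
        τ'.countP bad ≤ τ.countP bad ∧ s ∈ τ'.map Prod.fst ∧
        ∀ s' ∈ S, s' ∈ τ.map Prod.fst → s' ∈ τ'.map Prod.fst := by
    intro τ hτ hcard s hs hsτ
    obtain ⟨σ', τ', h1, h2, h3, h4, h5⟩ := exists_exchange σ τ s hσ hτ (by omega) (hσS s hs) hsτ
    have h6 := congrArg Multiset.card h3
    have h7 := congrArg (mcost A) h3
    have h8 := congrArg (Multiset.countP bad) h3
    simp only [Multiset.card_add, mcost_add, Multiset.countP_add] at h6 h7 h8
    have h9 := hD σ' h1 (by omega)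
    refine ⟨τ', h2, by omega, by linarith, by omega, ?_, fun s' hs' hs'τ => ?_⟩
    · refine mem_map_right_of_add_eq_of_notMem Prod.fst h3 ?_ h5
      rw [Multiset.map_add, Multiset.mem_add]
      exact Or.inl (hσS s hs)
    · exact mem_map_right_of_add_eq Prod.fst h3 (hσS s' hs') hs'τ h1.1
  induction hn : τ.countP bad + (S.filter fun s => s ∉ τ.map Prod.fst).card
    using Nat.strong_induction_on generalizing τ with
  | _ n ih =>
  subst hn
  by_cases hmiss : ∃ s ∈ S, s ∉ τ.map Prod.fst
  · obtain ⟨s, hs, hsτ⟩ := hmiss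
    obtain ⟨τ', h1, h2, h3, h4, h5, h6⟩ := key τ hτ hcard s hs hsτ
    refine (ih _ ?_ τ' h1 h2 rfl).trans h3
    refine add_lt_add_of_le_of_lt h4 (Finset.card_lt_card ?_)
    refine (Finset.ssubset_iff_of_subset ?_).2 ⟨s, by simp only [Finset.mem_filter]; exact ⟨hs, hsτ⟩,
      by simp only [Finset.mem_filter, not_and, not_not]; exact fun _ => h5⟩
    intro x hx
    rw [Finset.mem_filter] at hx ⊢
    exact ⟨hx.1, fun h => hx.2 (h6 x hx.1 h)⟩
  push Not at hmiss
  by_cases hbad : ∃ p ∈ τ, bad p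
  · obtain ⟨⟨s, γ⟩, hp, hs, hγ⟩ := hbad
    obtain ⟨τ₀, rfl⟩ := Multiset.exists_cons_of_mem hp
    obtain ⟨hτ1, hτ2, hτ3⟩ := isMatching_cons.1 hτ
    dsimp only at *
    -- A bad site `(s, γ)` moves to an unused row outside `S`, where it costs nothing. This leaves
    -- `s` missing, and `key` restores it.
    obtain ⟨e, he⟩ := Infinite.exists_notMem_finset (S ∪ (τ₀.map Prod.fst).toFinset)
    simp only [Finset.mem_union, Multiset.mem_toFinset, not_or] at he
    have hes : s ≠ e := by rintro rfl; exact he.1 hs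
    obtain ⟨τ', h1, h2, h3, h4, h5, h6⟩ := key ((e, γ) ::ₘ τ₀)
      (isMatching_cons.2 ⟨he.2, hτ2, hτ3⟩) (by simpa using hcard) s hs
      (by rw [Multiset.map_cons, Multiset.mem_cons, not_or]; exact ⟨hes, hτ1⟩)
    have h7 : mcost A ((e, γ) ::ₘ τ₀) ≤ mcost A ((s, γ) ::ₘ τ₀) := by
      rw [mcost_cons, mcost_cons]
      dsimp only
      rw [ha e he.1, hac γ hγ]
      linarith [hA s γ]
    have h8 : ((e, γ) ::ₘ τ₀).countP bad < ((s, γ) ::ₘ τ₀).countP bad := by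
      rw [Multiset.countP_cons_of_neg _ (fun h : bad (e, γ) => he.1 h.1),
        Multiset.countP_cons_of_pos _ (show bad (s, γ) from ⟨hs, hγ⟩)]
      omega
    refine (ih _ ?_ τ' h1 h2 rfl).trans (h3.trans h7)
    have h9 : (S.filter fun s => s ∉ τ'.map Prod.fst) = ∅ := by
      refine Finset.filter_eq_empty_iff.2 fun x hx => not_not.2 ?_
      by_cases hxs : x = s
      · exact hxs ▸ h5
      · have := hmiss x hx
        rw [Multiset.map_cons, Multiset.mem_cons] at this
        exact h6 x hx (by rw [Multiset.map_cons, Multiset.mem_cons]; tauto)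
    rw [h9, Finset.card_empty]
    omega
  push Not at hbad
  obtain ⟨f', r, y, π, rfl, hf', hr, hy, hf''⟩ := exists_split_matching hτ hcard hmiss
    fun p hp h1 h2 => hbad p hp ⟨h1, h2⟩
  have h1 := hY y hy f' hf' hf''
  have h2 : mcost A (S.val.map fun i => (i, f' i)) = ∑ i ∈ S, A i (f' i) := by
    simp only [mcost, Multiset.map_map, Function.comp_def]; rfl
  rw [mcost_cons, mcost_add, h2]
  have h3 := mcost_nonneg hA π
  have h4 := ha r hr y
  dsimp only
  linarith

end Augment

end RowParticipation
namespace RowParticipation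

/-! ### Covers, flats and the states of the greedy process. -/

section Flats

variable {R C : Type*}

/-- The sites of `Z` outside the rows in `X`. -/
def sitesOutside (Z : Set (R × C)) (X : Finset R) : Set (R × C) := {p | p ∈ Z ∧ p.1 ∉ X}

/-- The columns in `c` are a smallest cover of the sites of `Z` outside the rows in `S`, and remain
one if any further row is deleted. -/
structure IsFlat [DecidableEq R] (Z : Set (R × C)) (S : Finset R) (c : Finset C) : Prop where
  cover : ∀ p ∈ Z, p.1 ∈ S ∨ p.2 ∈ c
  le_card : ∀ G, IsCover (sitesOutside Z S) G → c.card ≤ G.card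
  le_card_insert : ∀ i ∉ S, ∀ G, IsCover (sitesOutside Z (insert i S)) G → c.card ≤ G.card

theorem rowMaximalOptimalCover_spec [Fintype R] [Fintype C] (Z : Set (R × C)) :
    IsRowMaximalOptimalCover Z (rowMaximalOptimalCover Z) :=
  (exists_rowMaximalOptimalCover Z).choose_spec

variable [DecidableEq R]

theorem card_union_disjSum_le [DecidableEq C] (L : Finset R) (G : Finset (R ⊕ C)) :
    (G ∪ L.disjSum ∅).card ≤ G.card + L.card := by
  refine (Finset.card_union_le _ _).trans ?_
  simp

/-- The sites of row `i` are deleted, so dropping `i` from the cover would save a file. -/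
theorem IsOptimalCover.inl_notMem {Z : Set (R × C)} {X : Finset R} {F : Finset (R ⊕ C)}
    (hF : IsOptimalCover (sitesOutside Z X) F) {i : R} (hi : i ∈ X) : Sum.inl i ∉ F := by
  classical
  intro hiF
  have h1 : IsCover (sitesOutside Z X) (F.erase (Sum.inl i)) := by
    intro p hp
    have h2 : p.1 ≠ i := by rintro rfl; exact hp.2 hi
    rcases hF.1 p hp with h | h
    · exact Or.inl (Finset.mem_erase.2 ⟨by simpa using h2, h⟩)
    · exact Or.inr (Finset.mem_erase.2 ⟨by simp, h⟩)
  have h2 := hF.2 _ h1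
  have h3 := Finset.card_erase_lt_of_mem hiF
  omega

theorem IsRowMaximalOptimalCover.disjoint {Z : Set (R × C)} {X : Finset R} {F : Finset (R ⊕ C)}
    (hF : IsRowMaximalOptimalCover (sitesOutside Z X) F) : Disjoint X F.toLeft := by
  rw [Finset.disjoint_left]
  intro i hi hiF
  exact hF.1.inl_notMem hi (Finset.mem_toLeft.1 hiF)

/-- If deleting a further row `i` lowered the cover number, the smaller cover together with `i` and
the rows of `F` would again be optimal, and row-maximality would put `i` into `F`. -/
theorem IsRowMaximalOptimalCover.isFlat {Z : Set (R × C)} {X : Finset R} {F : Finset (R ⊕ C)}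
    (hF : IsRowMaximalOptimalCover (sitesOutside Z X) F) :
    IsFlat Z (X ∪ F.toLeft) F.toRight := by
  classical
  have hcard := F.card_toLeft_add_card_toRight
  constructor
  · intro p hp
    by_cases hX : p.1 ∈ X
    · exact Or.inl (Finset.mem_union_left _ hX)
    · rcases hF.1.1 p ⟨hp, hX⟩ with h | h
      · exact Or.inl (Finset.mem_union_right _ (Finset.mem_toLeft.2 h))
      · exact Or.inr (Finset.mem_toRight.2 h)
  · intro G hG
    have h1 : IsCover (sitesOutside Z X) (G ∪ F.toLeft.disjSum ∅) := by
      intro p hp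
      by_cases h : p.1 ∈ F.toLeft
      · exact Or.inl (Finset.mem_union_right _ (by simpa using h))
      · have := hG p ⟨hp.1, by simpa [hp.2] using h⟩
        simp only [Finset.mem_union]
        tauto
    have h2 := hF.1.2 _ h1
    have h3 := card_union_disjSum_le F.toLeft G
    omega
  · intro i hi G hG
    by_contra! hlt
    have h1 : IsCover (sitesOutside Z X) (G ∪ (insert i F.toLeft).disjSum ∅) := by
      intro p hp
      by_cases h : p.1 ∈ insert i F.toLeft
      · exact Or.inl (Finset.mem_union_right _ (by simpa using h))
      · have := hG p ⟨hp.1, by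
          simp only [Finset.mem_insert, not_or, Finset.mem_union] at h ⊢
          exact ⟨h.1, hp.2, h.2⟩⟩
        simp only [Finset.mem_union]
        tauto
    have h3 := card_union_disjSum_le (insert i F.toLeft) G
    have h4 := Finset.card_insert_le i F.toLeft
    have h5 : IsOptimalCover (sitesOutside Z X) (G ∪ (insert i F.toLeft).disjSum ∅) :=
      ⟨h1, fun H hH => by have := hF.1.2 H hH; omega⟩
    have h6 := hF.2 _ h5 i (by simp)
    exact hi (Finset.mem_union_right _ (Finset.mem_toLeft.2 h6))

/-- The rows of an optimal cover can be matched to columns outside it. -/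
theorem IsOptimalCover.exists_row_matching [Nonempty C] {Z : Set (R × C)} [Finite C]
    {F : Finset (R ⊕ C)} (hF : IsOptimalCover Z F) :
    ∃ f : R → C, Set.InjOn f F.toLeft ∧ ∀ i ∈ F.toLeft, f i ∉ F.toRight ∧ (i, f i) ∈ Z := by
  classical
  have := Fintype.ofFinite C
  let t : {i // i ∈ F.toLeft} → Finset C := fun i =>
    Finset.univ.filter fun j => j ∉ F.toRight ∧ (i.1, j) ∈ Z
  -- Hall's condition: if the rows in `s` had too few admissible columns, trading these rows for
  -- those columns would give a smaller cover.
  have hall : ∀ s : Finset {i // i ∈ F.toLeft}, s.card ≤ (s.biUnion t).card := by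
    intro s
    have h1 : IsCover Z ((F.toLeft \ s.image Subtype.val).disjSum (F.toRight ∪ s.biUnion t)) := by
      intro p hp
      simp only [Finset.inl_mem_disjSum, Finset.inr_mem_disjSum, Finset.mem_sdiff,
        Finset.mem_union, Finset.mem_biUnion]
      by_cases hR : p.2 ∈ F.toRight
      · exact Or.inr (Or.inl hR)
      · have hL : p.1 ∈ F.toLeft := by
          rcases hF.1 p hp with h | h
          · exact Finset.mem_toLeft.2 h
          · exact absurd (Finset.mem_toRight.2 h) hR
        by_cases hs : p.1 ∈ s.image Subtype.val
        · obtain ⟨a, ha, hap⟩ := Finset.mem_image.1 hs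
          exact Or.inr (Or.inr ⟨a, ha, by simp only [t, Finset.mem_filter]; exact
            ⟨Finset.mem_univ _, hR, by rw [hap]; exact hp⟩⟩)
        · exact Or.inl ⟨hL, hs⟩
    have h2 := hF.2 _ h1
    rw [Finset.card_disjSum] at h2
    have h3 := Finset.card_union_le F.toRight (s.biUnion t)
    have h4 : s.image Subtype.val ⊆ F.toLeft := by
      intro x hx
      obtain ⟨a, -, rfl⟩ := Finset.mem_image.1 hx
      exact a.2
    have h5 := Finset.card_sdiff_add_card_eq_card h4
    rw [Finset.card_image_of_injective _ Subtype.val_injective] at h5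
    have h6 := F.card_toLeft_add_card_toRight
    omega
  obtain ⟨f, hf, hft⟩ := (Finset.all_card_le_biUnion_card_iff_exists_injective t).1 hall
  refine ⟨fun i => if h : i ∈ F.toLeft then f ⟨i, h⟩ else Classical.arbitrary C, ?_, ?_⟩
  · intro x hx y hy hxy
    simp only [Finset.mem_coe] at hx hy
    simp only [hx, hy, dif_pos] at hxy
    exact congrArg Subtype.val (hf hxy)
  · intro i hi
    have := hft ⟨i, hi⟩
    simp only [t, Finset.mem_filter, Finset.mem_univ, true_and] at this
    simpa only [hi, dif_pos] using this

/-- The columns of a flat can be matched to rows outside it. -/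
theorem IsFlat.exists_column_matching [Nonempty R] [Finite R] {Z : Set (R × C)} {S : Finset R}
    {c : Finset C} (h : IsFlat Z S c) :
    ∃ g : C → R, Set.InjOn g c ∧ ∀ j ∈ c, g j ∉ S ∧ (g j, j) ∈ Z := by
  classical
  have := Fintype.ofFinite R
  let t : {j // j ∈ c} → Finset R := fun j => Finset.univ.filter fun i => i ∉ S ∧ (i, j.1) ∈ Z
  have hall : ∀ s : Finset {j // j ∈ c}, s.card ≤ (s.biUnion t).card := by
    intro s
    have h1 : IsCover (sitesOutside Z S) ((s.biUnion t).disjSum (c \ s.image Subtype.val)) := by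
      intro p hp
      simp only [Finset.inl_mem_disjSum, Finset.inr_mem_disjSum, Finset.mem_sdiff,
        Finset.mem_biUnion]
      have hc : p.2 ∈ c := (h.cover p hp.1).resolve_left hp.2
      by_cases hs : p.2 ∈ s.image Subtype.val
      · obtain ⟨a, ha, hap⟩ := Finset.mem_image.1 hs
        exact Or.inl ⟨a, ha, by simp only [t, Finset.mem_filter]; exact
          ⟨Finset.mem_univ _, hp.2, by rw [hap]; exact hp.1⟩⟩
      · exact Or.inr ⟨hc, hs⟩
    have h2 := h.le_card _ h1
    rw [Finset.card_disjSum] at h2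
    have h4 : s.image Subtype.val ⊆ c := by
      intro x hx
      obtain ⟨a, -, rfl⟩ := Finset.mem_image.1 hx
      exact a.2
    have h5 := Finset.card_sdiff_add_card_eq_card h4
    rw [Finset.card_image_of_injective _ Subtype.val_injective] at h5
    omega
  obtain ⟨g, hg, hgt⟩ := (Finset.all_card_le_biUnion_card_iff_exists_injective t).1 hall
  refine ⟨fun j => if h : j ∈ c then g ⟨j, h⟩ else Classical.arbitrary R, ?_, ?_⟩
  · intro x hx y hy hxy
    simp only [Finset.mem_coe] at hx hy
    simp only [hx, hy, dif_pos] at hxy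
    exact congrArg Subtype.val (hg hxy)
  · intro j hj
    have := hgt ⟨j, hj⟩
    simp only [t, Finset.mem_filter, Finset.mem_univ, true_and] at this
    simpa only [hj, dif_pos] using this

/-- Adding a row to a flat and passing to the row-maximal optimal cover of the rest. -/
theorem IsFlat.card_of_insert {Z : Set (R × C)} {S : Finset R} {c : Finset C} (h : IsFlat Z S c)
    {i : R} (hi : i ∉ S) {F : Finset (R ⊕ C)}
    (hF : IsOptimalCover (sitesOutside Z (insert i S)) F) : F.card = c.card := by
  refine le_antisymm ?_ (h.le_card_insert i hi F hF.1)
  have := hF.2 ((∅ : Finset R).disjSum c) fun p hp => Or.inr (by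
    simpa using (h.cover p hp.1).resolve_left fun h' => hp.2 (Finset.mem_insert_of_mem h'))
  simpa using this

/-- All sites outside the rows of `S` lie in columns of `c`, so an optimal cover has no use for
other columns. -/
theorem IsFlat.toRight_subset_of_insert [Nonempty C] [Finite C] {Z : Set (R × C)} {S : Finset R}
    {c : Finset C} (h : IsFlat Z S c) {i : R} (hi : i ∉ S) {F : Finset (R ⊕ C)}
    (hF : IsOptimalCover (sitesOutside Z (insert i S)) F) : F.toRight ⊆ c := by
  classical
  obtain ⟨f, hf, hfF⟩ := hF.exists_row_matching
  have h1 := h.card_of_insert hi hF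
  have h2 := F.card_toLeft_add_card_toRight
  have h3 : F.toLeft.image f ⊆ c := by
    intro j hj
    obtain ⟨r, hr, rfl⟩ := Finset.mem_image.1 hj
    have h4 := (hfF r hr).2
    exact (h.cover _ h4.1).resolve_left fun h' => h4.2 (Finset.mem_insert_of_mem h')
  have h5 : F.toLeft.disjSum (F.toRight ∩ c) ⊆ F := by
    intro x hx
    rcases x with x | x
    · simpa using hx
    · simp at hx ⊢; exact hx.1
  have h6 : IsCover (sitesOutside Z (insert i S)) (F.toLeft.disjSum (F.toRight ∩ c)) := by
    intro p hp
    have hc := (h.cover _ hp.1).resolve_left fun h' => hp.2 (Finset.mem_insert_of_mem h')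
    rcases hF.1 p hp with h' | h'
    · exact Or.inl (by simpa using h')
    · exact Or.inr (by simp [h', hc])
  have h7 := Finset.eq_of_subset_of_card_le h5 (hF.2 _ h6)
  intro j hj
  rw [← h7, Finset.toRight_disjSum] at hj
  exact (Finset.mem_inter.1 hj).2

/-- The state of the greedy process after choosing the rows in a list (last choice first): a set of
rows and a set of columns that together cover `Z`. -/
noncomputable def greedyState [Fintype R] [Fintype C] (Z : Set (R × C)) :
    List R → Finset R × Finset C
  | [] => ((rowMaximalOptimalCover Z).toLeft, (rowMaximalOptimalCover Z).toRight)
  | i :: l =>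
    let X := insert i (greedyState Z l).1
    (X ∪ (rowMaximalOptimalCover (sitesOutside Z X)).toLeft,
      (rowMaximalOptimalCover (sitesOutside Z X)).toRight)

variable [Fintype R] [Fintype C]

theorem isFlat_greedyState (Z : Set (R × C)) (l : List R) :
    IsFlat Z (greedyState Z l).1 (greedyState Z l).2 := by
  cases l with
  | nil =>
    have h0 : sitesOutside Z ∅ = Z := by simp [sitesOutside]
    have h := rowMaximalOptimalCover_spec Z
    rw [← h0] at h
    have h2 := h.isFlat
    rw [Finset.empty_union, h0] at h2
    exact h2
  | cons i l => exact (rowMaximalOptimalCover_spec _).isFlat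

/-- A list of rows, each of which lies outside the state reached by the later entries. -/
def IsPath (Z : Set (R × C)) : List R → Prop
  | [] => True
  | i :: l => i ∉ (greedyState Z l).1 ∧ IsPath Z l

/-- A choice adds one row to the state and, by the last condition of `IsFlat`, leaves the cover
number of the remaining sites at `|c|`. -/
theorem card_greedyState (Z : Set (R × C)) (l : List R) (hl : IsPath Z l) :
    (greedyState Z l).1.card + (greedyState Z l).2.card =
      (rowMaximalOptimalCover Z).card + l.length := by
  induction l with
  | nil => simpa [greedyState] using Finset.card_toLeft_add_card_toRight
  | cons i l ih =>
    have h1 := ih hl.2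
    have h2 := rowMaximalOptimalCover_spec (sitesOutside Z (insert i (greedyState Z l).1))
    have h3 := (isFlat_greedyState Z l).card_of_insert hl.1 h2.1
    have h4 := Finset.card_toLeft_add_card_toRight
      (u := rowMaximalOptimalCover (sitesOutside Z (insert i (greedyState Z l).1)))
    simp only [greedyState, List.length_cons]
    rw [Finset.card_union_of_disjoint h2.disjoint, Finset.card_insert_of_notMem hl.1]
    omega

theorem insert_subset_greedyState (Z : Set (R × C)) (i : R) (l : List R) :
    insert i (greedyState Z l).1 ⊆ (greedyState Z (i :: l)).1 :=
  Finset.subset_union_left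

theorem greedyState_snd_subset [Nonempty C] (Z : Set (R × C)) {i : R} {l : List R}
    (hi : i ∉ (greedyState Z l).1) : (greedyState Z (i :: l)).2 ⊆ (greedyState Z l).2 :=
  (isFlat_greedyState Z l).toRight_subset_of_insert hi (rowMaximalOptimalCover_spec _).1

theorem mem_greedyState_of_mem (Z : Set (R × C)) {i : R} {l : List R} (h : i ∈ l) :
    i ∈ (greedyState Z l).1 := by
  induction l with
  | nil => simp at h
  | cons i' l ih =>
    refine insert_subset_greedyState Z i' l ?_
    rcases List.mem_cons.1 h with rfl | h
    · exact Finset.mem_insert_self _ _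
    · exact Finset.mem_insert_of_mem (ih h)

/-- A row without sites of `Z` enters the state only when it is chosen. -/
theorem mem_of_mem_greedyState [Nonempty C] (Z : Set (R × C)) {i₀ : R} (hi₀ : ∀ j, (i₀, j) ∉ Z)
    {l : List R} (h : i₀ ∈ (greedyState Z l).1) : i₀ ∈ l := by
  induction l with
  | nil =>
    obtain ⟨f, -, hf⟩ := (rowMaximalOptimalCover_spec Z).1.exists_row_matching
    exact absurd (hf i₀ h).2 (hi₀ _)
  | cons i l ih =>
    rcases Finset.mem_union.1 h with h | h
    · rcases Finset.mem_insert.1 h with rfl | h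
      · exact List.mem_cons_self
      · exact List.mem_cons_of_mem _ (ih h)
    · obtain ⟨f, -, hf⟩ := (rowMaximalOptimalCover_spec
        (sitesOutside Z (insert i (greedyState Z l).1))).1.exists_row_matching
      exact absurd (hf i₀ h).2.1 (hi₀ _)

/-- A cover that contains all rows of a path is at least as large as the state it leads to. -/
theorem card_greedyState_le_card [DecidableEq C] (Z : Set (R × C)) {l : List R} (hl : IsPath Z l)
    {G : Finset (R ⊕ C)} (hG : IsCover Z G) (hlG : ∀ i ∈ l, Sum.inl i ∈ G) :
    (rowMaximalOptimalCover Z).card + l.length ≤ G.card := by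
  induction l generalizing G with
  | nil => simpa using (rowMaximalOptimalCover_spec Z).1.2 G hG
  | cons i l ih =>
    have hflat := isFlat_greedyState Z l
    have hcard := card_greedyState Z l hl.2
    set S := (greedyState Z l).1 with hS
    set c := (greedyState Z l).2 with hc
    -- Uncross `G` with the state. The cover in `h1` contains the earlier rows of the path and is
    -- bounded by induction; the one in `h3` covers the sites outside `insert i S` and needs
    -- `c.card` files. Their sizes add up to `G.card + c.card - 1`, because `i` is in neither.
    have h1 : IsCover Z ((G.toLeft ∩ S).disjSum (G.toRight ∪ c)) := by
      intro p hp
      have := hflat.cover p hp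
      have := hG p hp
      simp only [Finset.inl_mem_disjSum, Finset.inr_mem_disjSum, Finset.mem_union,
        Finset.mem_inter, Finset.mem_toLeft, Finset.mem_toRight]
      tauto
    have h2 := ih hl.2 h1 fun r hr => by
      simp only [Finset.inl_mem_disjSum, Finset.mem_inter, Finset.mem_toLeft]
      exact ⟨hlG r (List.mem_cons_of_mem _ hr), mem_greedyState_of_mem Z hr⟩
    have h3 : IsCover (sitesOutside Z (insert i S))
        ((G.toLeft \ insert i S).disjSum (G.toRight ∩ c)) := by
      intro p hp
      have h4 := (hflat.cover _ hp.1).resolve_left fun h' => hp.2 (Finset.mem_insert_of_mem h')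
      have := hG p hp.1
      have := hp.2
      simp only [Finset.inl_mem_disjSum, Finset.inr_mem_disjSum, Finset.mem_sdiff,
        Finset.mem_inter, Finset.mem_toLeft, Finset.mem_toRight]
      tauto
    have h4 := hflat.le_card_insert i hl.1 _ h3
    rw [Finset.card_disjSum] at h2 h4
    have h5 := G.card_toLeft_add_card_toRight
    have h6 := Finset.card_union_add_card_inter G.toRight c
    have h7 := Finset.card_sdiff_add_card_inter G.toLeft (insert i S)
    have h8 : (G.toLeft ∩ insert i S).card = (G.toLeft ∩ S).card + 1 := by
      rw [Finset.inter_insert_of_mem (Finset.mem_toLeft.2 (hlG i List.mem_cons_self)),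
        Finset.card_insert_of_notMem fun h => hl.1 (Finset.mem_inter.1 h).2]
    simp only [List.length_cons]
    omega

end Flats

end RowParticipation

namespace RowParticipation

/-! ### Optimality of the greedy algorithm. -/

section Greedy

variable {R C : Type*} [Fintype R] [Fintype C]

/-- The minimum cost of an assignment of the rows in `S` to columns outside `E`. -/
noncomputable def partialCost (M : R → C → ℝ) (S : Finset R) (E : Finset C) : ℝ :=
  ⨅ f : {f : R → C // Set.InjOn f S ∧ ∀ i ∈ S, f i ∉ E}, ∑ i ∈ S, M i (f.1 i)

theorem partialCost_le (M : R → C → ℝ) {S : Finset R} {E : Finset C} {f : R → C}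
    (hf : Set.InjOn f S) (hfE : ∀ i ∈ S, f i ∉ E) : partialCost M S E ≤ ∑ i ∈ S, M i (f i) := by
  classical
  exact ciInf_le (Set.finite_range _).bddBelow
    (⟨f, hf, hfE⟩ : {f : R → C // Set.InjOn f S ∧ ∀ i ∈ S, f i ∉ E})

theorem exists_partialCost_eq [Nonempty C] (M : R → C → ℝ) {S : Finset R} {E : Finset C}
    (h : S.card + E.card ≤ Fintype.card C) :
    ∃ f : R → C, Set.InjOn f S ∧ (∀ i ∈ S, f i ∉ E) ∧ partialCost M S E = ∑ i ∈ S, M i (f i) := by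
  classical
  have : Nonempty {f : R → C // Set.InjOn f S ∧ ∀ i ∈ S, f i ∉ E} := by
    have h1 : S.card ≤ Eᶜ.card := by rw [Finset.card_compl]; omega
    obtain ⟨f, hf, hfi⟩ := Finset.exists_subset_card_eq h1 |>.imp fun t ht => ht
    obtain ⟨e⟩ : Nonempty (S ≃ f) := ⟨Finset.equivOfCardEq hfi.symm⟩
    refine ⟨fun i => if h : i ∈ S then e ⟨i, h⟩ else Classical.arbitrary C, ?_, ?_⟩
    · intro x hx y hy hxy
      simp only [Finset.mem_coe] at hx hy
      simp only [hx, hy, dif_pos] at hxy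
      exact congrArg Subtype.val (e.injective (Subtype.ext hxy))
    · intro i hi
      simp only [hi, dif_pos]
      exact Finset.mem_compl.1 (hf (e ⟨i, hi⟩).2)
  obtain ⟨f, hf⟩ := exists_eq_ciInf_of_finite
    (f := fun f : {f : R → C // Set.InjOn f S ∧ ∀ i ∈ S, f i ∉ E} => ∑ i ∈ S, M i (f.1 i))
  exact ⟨f.1, f.2.1, f.2.2, hf.symm⟩

theorem partialCost_congr {M M' : R → C → ℝ} {S : Finset R} (h : ∀ i ∈ S, M i = M' i)
    (E : Finset C) : partialCost M S E = partialCost M' S E := by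
  unfold partialCost
  exact iInf_congr fun f => Finset.sum_congr rfl fun i hi => by rw [h i hi]

variable [DecidableEq R]

/-- The minimum of a column over the rows outside `S`, or `0` in the columns of `c`. -/
noncomputable def relaxedMin (M : R → C → ℝ) (S : Finset R) (c : Finset C) [DecidableEq C]
    (j : C) : ℝ :=
  if j ∈ c then 0 else ⨅ i : {i // i ∉ S}, M i j

/-- The matrix whose rows outside `S` are replaced by copies of `relaxedMin`, with additional rows of
the same kind. -/
noncomputable def relaxedMatrix (M : R → C → ℝ) (S : Finset R) (c : Finset C) [DecidableEq C] :
    R ⊕ ℕ → C → ℝ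
  | Sum.inl i, j => if i ∈ S then M i j else relaxedMin M S c j
  | Sum.inr _, j => relaxedMin M S c j

variable [DecidableEq C]

theorem relaxedMin_nonneg {M : R → C → ℝ} (hM : ∀ i j, 0 ≤ M i j) (S : Finset R) (c : Finset C)
    (j : C) : 0 ≤ relaxedMin M S c j := by
  unfold relaxedMin
  split_ifs
  · exact le_rfl
  · exact Real.iInf_nonneg fun i => hM i j

theorem relaxedMin_le {M : R → C → ℝ} (hM : ∀ i j, 0 ≤ M i j) {S : Finset R} (c : Finset C)
    {i : R} (hi : i ∉ S) (j : C) : relaxedMin M S c j ≤ M i j := by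
  unfold relaxedMin
  split_ifs
  · exact hM i j
  · exact ciInf_le (f := fun i : {i // i ∉ S} => M i j) (Set.finite_range _).bddBelow ⟨i, hi⟩

theorem exists_relaxedMin_eq (M : R → C → ℝ) {S : Finset R} {c : Finset C} {j : C} (hj : j ∉ c)
    (hS : ∃ i, i ∉ S) : ∃ i ∉ S, relaxedMin M S c j = M i j := by
  have : Nonempty {i // i ∉ S} := hS.elim fun i hi => ⟨⟨i, hi⟩⟩
  obtain ⟨i, hi⟩ := exists_eq_ciInf_of_finite (f := fun i : {i // i ∉ S} => M i j)
  refine ⟨i, i.2, ?_⟩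
  rw [relaxedMin, if_neg hj, hi]

theorem relaxedMatrix_nonneg {M : R → C → ℝ} (hM : ∀ i j, 0 ≤ M i j) (S : Finset R)
    (c : Finset C) (i : R ⊕ ℕ) (j : C) : 0 ≤ relaxedMatrix M S c i j := by
  rcases i with i | n
  · simp only [relaxedMatrix]
    split_ifs
    · exact hM i j
    · exact relaxedMin_nonneg hM S c j
  · exact relaxedMin_nonneg hM S c j

theorem relaxedMatrix_inl_le {M : R → C → ℝ} (hM : ∀ i j, 0 ≤ M i j) (S : Finset R)
    (c : Finset C) (i : R) (j : C) : relaxedMatrix M S c (Sum.inl i) j ≤ M i j := by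
  simp only [relaxedMatrix]
  split_ifs with h
  · exact le_rfl
  · exact relaxedMin_le hM c h j

/-- A larger state minimizes over fewer rows and sets fewer columns to zero. A row must remain
outside `S'`, since a real infimum over an empty type is `0`. -/
theorem relaxedMin_mono {M : R → C → ℝ} (hM : ∀ i j, 0 ≤ M i j) {S S' : Finset R}
    {c c' : Finset C} (hS : S ⊆ S') (hc : c' ⊆ c) (hS' : ∃ i, i ∉ S') (j : C) :
    relaxedMin M S c j ≤ relaxedMin M S' c' j := by
  by_cases hj : j ∈ c
  · rw [relaxedMin, if_pos hj]
    exact relaxedMin_nonneg hM _ _ _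
  · obtain ⟨i, hi, h⟩ := exists_relaxedMin_eq M (fun h => hj (hc h)) hS'
    rw [h]
    exact relaxedMin_le hM c (fun h => hi (hS h)) j

theorem relaxedMatrix_mono {M : R → C → ℝ} (hM : ∀ i j, 0 ≤ M i j) {S S' : Finset R}
    {c c' : Finset C} (hS : S ⊆ S') (hc : c' ⊆ c) (hS' : ∃ i, i ∉ S') (i : R ⊕ ℕ) (j : C) :
    relaxedMatrix M S c i j ≤ relaxedMatrix M S' c' i j := by
  rcases i with i | n
  · by_cases h' : i ∈ S'
    · refine (relaxedMatrix_inl_le hM S c i j).trans ?_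
      simp [relaxedMatrix, h']
    · have h : i ∉ S := fun h => h' (hS h)
      simp only [relaxedMatrix, h, h', if_false]
      exact relaxedMin_mono hM hS hc hS' j
  · exact relaxedMin_mono hM hS hc hS' j

/-- Each entry `i` of the list minimizes, over the rows outside the state reached by the later
entries, the cost of extending the current partial assignment. -/
def IsGreedy (Z : Set (R × C)) (M : R → C → ℝ) : List R → Prop
  | [] => True
  | i :: l => IsGreedy Z M l ∧ ∃ j ∉ (greedyState Z l).2,
      ∀ i' ∉ (greedyState Z l).1, ∀ j' ∉ (greedyState Z l).2,
        M i j + partialCost M (greedyState Z l).1 (insert j (greedyState Z l).2) ≤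
          M i' j' + partialCost M (greedyState Z l).1 (insert j' (greedyState Z l).2)

variable [Nonempty C] {Z : Set (R × C)} {M : R → C → ℝ}

theorem partialCost_greedyState_nil (hZ : ∀ i j, (i, j) ∈ Z → M i j = 0) :
    partialCost M (greedyState Z []).1 (greedyState Z []).2 ≤ 0 := by
  obtain ⟨f, hf, hf'⟩ := (rowMaximalOptimalCover_spec Z).1.exists_row_matching
  refine (partialCost_le M hf fun i hi => (hf' i hi).1).trans (le_of_eq ?_)
  exact Finset.sum_eq_zero fun i hi => hZ _ _ (hf' i hi).2

/-- Extend a cheapest assignment of `S` outside `insert j c` by `(i, j)`, and place the rows newly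
absorbed by the cover on zeros in the columns of `c` that it releases. -/
theorem partialCost_greedyState_cons (hZ : ∀ i j, (i, j) ∈ Z → M i j = 0) {i : R} {l : List R}
    (hi : i ∉ (greedyState Z l).1) {j : C} (hj : j ∉ (greedyState Z l).2)
    (hcard : (greedyState Z l).1.card + (greedyState Z l).2.card + 1 ≤ Fintype.card C) :
    partialCost M (greedyState Z (i :: l)).1 (greedyState Z (i :: l)).2 ≤
      M i j + partialCost M (greedyState Z l).1 (insert j (greedyState Z l).2) := by
  have hflat := isFlat_greedyState Z l
  have hsub := greedyState_snd_subset Z hi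
  have hspec := rowMaximalOptimalCover_spec (sitesOutside Z (insert i (greedyState Z l).1))
  simp only [greedyState] at hsub ⊢
  set S := (greedyState Z l).1
  set c := (greedyState Z l).2
  set F := rowMaximalOptimalCover (sitesOutside Z (insert i S)) with hF
  obtain ⟨f, hf, hfc, hfe⟩ := exists_partialCost_eq M (S := S) (E := insert j c) (by
    rw [Finset.card_insert_of_notMem hj]; omega)
  obtain ⟨g, hg, hgF⟩ := hspec.1.exists_row_matching
  have hgc : ∀ r ∈ F.toLeft, g r ∈ c := fun r hr =>
    (hflat.cover _ (hgF r hr).2.1).resolve_left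
      fun h => (hgF r hr).2.2 (Finset.mem_insert_of_mem h)
  have hgX : ∀ r ∈ F.toLeft, r ∉ S ∧ r ≠ i := fun r hr => by
    have := (hgF r hr).2.2
    simp only [Finset.mem_insert, not_or] at this
    exact ⟨this.2, this.1⟩
  let f' : R → C := fun r => if r ∈ S then f r else if r = i then j else g r
  have hS' : ∀ r ∈ S, f' r = f r := fun r hr => if_pos hr
  have hi' : f' i = j := by simp only [f', if_neg hi, if_true]
  have hF' : ∀ r ∈ F.toLeft, f' r = g r := fun r hr => by
    simp only [f', if_neg (hgX r hr).1, if_neg (hgX r hr).2]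
  have hfc' : ∀ r ∈ S, f r ≠ j ∧ f r ∉ c := fun r hr => by
    simpa only [Finset.mem_insert, not_or] using hfc r hr
  have hcase : ∀ r ∈ insert i S ∪ F.toLeft, r = i ∨ r ∈ S ∨ r ∈ F.toLeft := fun r hr => by
    simpa only [Finset.mem_union, Finset.mem_insert, or_assoc] using hr
  refine (partialCost_le M (f := f') ?_ ?_).trans (le_of_eq ?_)
  · intro x hx y hy hxy
    have hx₀ := hcase x hx
    have hy₀ := hcase y hy
    clear hx hy
    rcases hx₀ with rfl | hx | hx <;> rcases hy₀ with rfl | hy | hy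
    · rfl
    · rw [hi', hS' y hy] at hxy; exact absurd hxy.symm (hfc' y hy).1
    · rw [hi', hF' y hy] at hxy; exact absurd (hxy ▸ hgc y hy) hj
    · rw [hi', hS' x hx] at hxy; exact absurd hxy (hfc' x hx).1
    · rw [hS' x hx, hS' y hy] at hxy; exact hf hx hy hxy
    · rw [hS' x hx, hF' y hy] at hxy; exact absurd (hxy ▸ hgc y hy) (hfc' x hx).2
    · rw [hi', hF' x hx] at hxy; exact absurd (hxy ▸ hgc x hx) hj
    · rw [hF' x hx, hS' y hy] at hxy; exact absurd (hxy ▸ hgc x hx) (hfc' y hy).2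
    · rw [hF' x hx, hF' y hy] at hxy; exact hg hx hy hxy
  · intro r hr
    rcases hcase r hr with rfl | hr | hr
    · rw [hi']; exact fun h => hj (hsub h)
    · rw [hS' r hr]; exact fun h => (hfc' r hr).2 (hsub h)
    · rw [hF' r hr]; exact (hgF r hr).1
  · rw [Finset.sum_union hspec.disjoint, Finset.sum_insert hi, hi', hfe,
      Finset.sum_congr rfl fun r hr => by rw [hS' r hr], Finset.sum_eq_zero (s := F.toLeft), add_zero]
    intro r hr
    rw [hF' r hr]
    exact hZ _ _ (hgF r hr).2.1

/-- In the relaxed matrix the rows outside `S` are interchangeable, so `le_mcost_of_augment`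
applies. Off `c` the value `relaxedMin` is attained in an actual row, hence the greedy choice gives
the bound for every possible added site. -/
theorem partialCost_cons_le_mcost_relaxedMatrix (hM : ∀ i j, 0 ≤ M i j)
    (hZ : ∀ i j, (i, j) ∈ Z → M i j = 0) {i : R} {l : List R} (hi : i ∉ (greedyState Z l).1)
    (hl : IsGreedy Z M (i :: l))
    (hcard : (greedyState Z l).1.card + (greedyState Z l).2.card + 1 ≤ Fintype.card C)
    (h : ∀ σ, IsMatching σ → σ.card = (greedyState Z l).1.card + (greedyState Z l).2.card →
      partialCost M (greedyState Z l).1 (greedyState Z l).2 ≤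
        mcost (relaxedMatrix M (greedyState Z l).1 (greedyState Z l).2) σ)
    (τ : Multiset ((R ⊕ ℕ) × C)) (hτ : IsMatching τ)
    (hτc : τ.card = (greedyState Z l).1.card + (greedyState Z l).2.card + 1) :
    partialCost M (greedyState Z (i :: l)).1 (greedyState Z (i :: l)).2 ≤
      mcost (relaxedMatrix M (greedyState Z l).1 (greedyState Z l).2) τ := by
  obtain ⟨-, j, hj, hmin⟩ := hl
  refine (partialCost_greedyState_cons hZ hi hj hcard).trans ?_
  set S := (greedyState Z l).1
  set c := (greedyState Z l).2
  obtain ⟨f, hf, hfc, hfe⟩ := exists_partialCost_eq M (S := S) (E := c) (by omega)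
  have hsum : ∀ f : R ⊕ ℕ → C, ∑ r ∈ S.map Function.Embedding.inl,
      relaxedMatrix M S c r (f r) = ∑ r ∈ S, M r (f (Sum.inl r)) := by
    intro f
    rw [Finset.sum_map]
    exact Finset.sum_congr rfl fun r hr => by simp [relaxedMatrix, hr]
  refine le_mcost_of_augment (S := S.map Function.Embedding.inl) (c := c)
    (a := relaxedMin M S c) (D := partialCost M S c) (relaxedMatrix_nonneg hM S c) ?_
    (fun j hj => by rw [relaxedMin, if_pos hj]) ?_ (Sum.elim f fun _ => Classical.arbitrary C)
    ?_ ?_ ?_ ?_ τ hτ (by rw [Finset.card_map]; exact hτc)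
  · intro r hr j'
    rcases r with r | n
    · have : r ∉ S := fun h => hr (Finset.mem_map.2 ⟨r, h, rfl⟩)
      simp [relaxedMatrix, this]
    · rfl
  · intro σ hσ hσc
    rw [Finset.card_map] at hσc
    exact h σ hσ hσc
  · rintro x hx y hy hxy
    obtain ⟨x, hx', rfl⟩ := Finset.mem_map.1 hx
    obtain ⟨y, hy', rfl⟩ := Finset.mem_map.1 hy
    exact congrArg _ (hf hx' hy' hxy)
  · intro r hr
    obtain ⟨r, hr', rfl⟩ := Finset.mem_map.1 hr
    exact hfc r hr'
  · rw [hsum, hfe]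
    exact le_rfl
  · intro j' hj' f' hf' hfc'
    obtain ⟨i', hi', h'⟩ := exists_relaxedMin_eq M hj' ⟨i, hi⟩
    rw [hsum, h']
    refine (hmin i' hi' j' hj').trans (add_le_add le_rfl (partialCost_le M
      (f := fun r => f' (Sum.inl r)) ?_ ?_))
    · intro x hx y hy hxy
      exact Sum.inl_injective (hf' (Finset.mem_map.2 ⟨x, hx, rfl⟩)
        (Finset.mem_map.2 ⟨y, hy, rfl⟩) hxy)
    · intro r hr
      have := hfc' (Sum.inl r) (Finset.mem_map.2 ⟨r, hr, rfl⟩)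
      simp only [Finset.mem_insert, not_or]
      exact ⟨this.2, this.1⟩

/-- The invariant of the algorithm is optimality in the relaxed matrix, a stronger statement than
optimality in `M`, and it passes to the next state by augmentation. Replacing the relaxed matrix of
`l` by the larger one of `i :: l` needs a row outside the new state, hence the strict inequality
`hR`. -/
theorem partialCost_le_mcost_relaxedMatrix (hM : ∀ i j, 0 ≤ M i j)
    (hZ : ∀ i j, (i, j) ∈ Z → M i j = 0) {l : List R} (hp : IsPath Z l) (hl : IsGreedy Z M l)
    (hR : (rowMaximalOptimalCover Z).card + l.length < Fintype.card R)
    (hC : (rowMaximalOptimalCover Z).card + l.length ≤ Fintype.card C) :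
    ∀ σ, IsMatching σ → σ.card = (greedyState Z l).1.card + (greedyState Z l).2.card →
      partialCost M (greedyState Z l).1 (greedyState Z l).2 ≤
        mcost (relaxedMatrix M (greedyState Z l).1 (greedyState Z l).2) σ := by
  induction l with
  | nil =>
    intro σ _ _
    exact (partialCost_greedyState_nil hZ).trans (mcost_nonneg (relaxedMatrix_nonneg hM _ _) _)
  | cons i l ih =>
    intro σ hσ hσc
    rw [card_greedyState Z _ hp] at hσc
    simp only [List.length_cons] at hR hC hσc
    have hcl := card_greedyState Z l hp.2
    have hcl' := card_greedyState Z _ hp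
    simp only [List.length_cons] at hcl'
    refine (partialCost_cons_le_mcost_relaxedMatrix hM hZ hp.1 hl (by omega)
      (ih hp.2 hl.1 (by omega) (by omega)) σ hσ (by omega)).trans (mcost_mono ?_ σ)
    refine relaxedMatrix_mono hM ((Finset.subset_insert _ _).trans
      (insert_subset_greedyState Z i l)) (greedyState_snd_subset Z hp.1) ?_
    by_contra! h
    have := Finset.eq_univ_iff_forall.2 h
    rw [this, Finset.card_univ] at hcl'
    omega

/-- A greedy path leads to a lower bound for the cost of assignments of the corresponding size. -/
theorem IsGreedy.partialCost_le (hM : ∀ i j, 0 ≤ M i j)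
    (hZ : ∀ i j, (i, j) ∈ Z → M i j = 0) {l : List R} (hp : IsPath Z l) (hl : IsGreedy Z M l)
    (hR : (rowMaximalOptimalCover Z).card + l.length ≤ Fintype.card R)
    (hC : (rowMaximalOptimalCover Z).card + l.length ≤ Fintype.card C)
    {π : Finset (R × C)}
    (hπ : IsAssignment ((rowMaximalOptimalCover Z).card + l.length) π) :
    partialCost M (greedyState Z l).1 (greedyState Z l).2 ≤ cost M π := by
  cases l with
  | nil =>
    exact (partialCost_greedyState_nil hZ).trans (Finset.sum_nonneg fun p _ => hM _ _)
  | cons i l =>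
    have hcl := card_greedyState Z l hp.2
    simp only [List.length_cons] at hR hC hπ
    -- The last step is compared in the relaxed matrix of `l`, not of `i :: l`, so `hR` need not be
    -- strict here.
    let τ : Multiset ((R ⊕ ℕ) × C) := π.val.map (Prod.map Sum.inl id)
    have hτ : IsMatching τ := by
      simp only [IsMatching, τ, Multiset.map_map]
      constructor
      · refine π.nodup.map_on fun p hp q hq h => ?_
        by_contra hpq
        exact (hπ.2 p hp q hq hpq).1 (Sum.inl_injective h)
      · refine π.nodup.map_on fun p hp q hq h => ?_
        by_contra hpq
        exact (hπ.2 p hp q hq hpq).2 h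
    have hτc : τ.card = _ := (Multiset.card_map _ _).trans hπ.1
    refine (partialCost_cons_le_mcost_relaxedMatrix hM hZ hp.1 hl (by omega)
      (partialCost_le_mcost_relaxedMatrix hM hZ hp.2 hl.1 (by omega) (by omega)) τ hτ
      (by omega)).trans ?_
    simp only [mcost, τ, Multiset.map_map, cost]
    exact Multiset.sum_map_le_sum_map _ _ fun p _ => relaxedMatrix_inl_le hM _ _ _ _

/-- The assignment that a path leads to. -/
theorem exists_isAssignment_cost_eq [Nonempty R] (hZ : ∀ i j, (i, j) ∈ Z → M i j = 0) {l : List R}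
    (hp : IsPath Z l) (hC : (rowMaximalOptimalCover Z).card + l.length ≤ Fintype.card C) :
    ∃ π : Finset (R × C), IsAssignment ((rowMaximalOptimalCover Z).card + l.length) π ∧
      cost M π = partialCost M (greedyState Z l).1 (greedyState Z l).2 ∧
      ∀ i ∈ (greedyState Z l).1, ∃ p ∈ π, p.1 = i := by
  have hcl := card_greedyState Z l hp
  obtain ⟨g, hg, hgS⟩ := (isFlat_greedyState Z l).exists_column_matching
  set S := (greedyState Z l).1
  set c := (greedyState Z l).2
  obtain ⟨f, hf, hfc, hfe⟩ := exists_partialCost_eq M (S := S) (E := c) (by omega)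
  have h1 := isMatching_graphMatching hf hfc hg fun j hj => (hgS j hj).1
  refine ⟨⟨graphMatching S c f g, h1.nodup⟩, ⟨?_, ?_⟩, ?_, ?_⟩
  · rw [Finset.card_mk, card_graphMatching, hcl]
  · intro p hp q hq hpq
    exact ⟨fun h => hpq (Multiset.inj_on_of_nodup_map h1.1 p hp q hq h),
      fun h => hpq (Multiset.inj_on_of_nodup_map h1.2 p hp q hq h)⟩
  · have h2 := mcost_graphMatching M S c f g
    rw [Finset.sum_eq_zero fun j hj => hZ _ _ (hgS j hj).2, add_zero, ← hfe] at h2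
    exact h2
  · intro i hi
    exact ⟨(i, f i), Multiset.mem_add.2 (Or.inl (Multiset.mem_map.2 ⟨i, hi, rfl⟩)), rfl⟩

theorem IsGreedy.mem_participatingRows [Nonempty R] (hM : ∀ i j, 0 ≤ M i j)
    (hZ : ∀ i j, (i, j) ∈ Z → M i j = 0) {l : List R} (hp : IsPath Z l) (hl : IsGreedy Z M l)
    (hR : (rowMaximalOptimalCover Z).card + l.length ≤ Fintype.card R)
    (hC : (rowMaximalOptimalCover Z).card + l.length ≤ Fintype.card C) {i : R} (hi : i ∈ l) :
    i ∈ participatingRows ((rowMaximalOptimalCover Z).card + l.length) M := by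
  obtain ⟨π, h1, h2, h3⟩ := exists_isAssignment_cost_eq hZ hp hC
  exact ⟨π, ⟨h1, fun π' hπ' => h2.le.trans (hl.partialCost_le hM hZ hp hR hC hπ')⟩,
    h3 i (mem_greedyState_of_mem Z hi)⟩

/-- If a path remains greedy when the entries in a row outside of it are lowered, then that row does
not participate. -/
theorem IsGreedy.notMem_participatingRows [Nonempty R] {M' : R → C → ℝ} {i₀ : R}
    (hi₀ : ∀ j, (i₀, j) ∉ Z)
    (hM'0 : ∀ i j, 0 ≤ M' i j) (hlt : ∀ j, M' i₀ j < M i₀ j) (heq : ∀ i ≠ i₀, M' i = M i)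
    (hZ : ∀ i j, (i, j) ∈ Z → M i j = 0) {l : List R} (hp : IsPath Z l) (hl : IsGreedy Z M' l)
    (hR : (rowMaximalOptimalCover Z).card + l.length ≤ Fintype.card R)
    (hC : (rowMaximalOptimalCover Z).card + l.length ≤ Fintype.card C) (hi : i₀ ∉ l) :
    i₀ ∉ participatingRows ((rowMaximalOptimalCover Z).card + l.length) M := by
  rintro ⟨π, hπ, p, hpπ, rfl⟩
  obtain ⟨π', h1, h2, -⟩ := exists_isAssignment_cost_eq hZ hp hC
  have hZ' : ∀ i j, (i, j) ∈ Z → M' i j = 0 := fun i j h => by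
    rw [heq i (by rintro rfl; exact hi₀ j h), hZ i j h]
  -- As the path avoids `i₀`, the lower bound for `M'` is also the cost of `π'` in `M`. An optimal
  -- `π` through `i₀` is strictly cheaper in `M'` than in `M` and would fall below that bound.
  have h3 := hl.partialCost_le hM'0 hZ' hp hR hC hπ.1
  have h4 : partialCost M' (greedyState Z l).1 (greedyState Z l).2 =
      partialCost M (greedyState Z l).1 (greedyState Z l).2 :=
    partialCost_congr (fun i h => heq i (by
      rintro rfl; exact hi (mem_of_mem_greedyState Z hi₀ h))) _
  have h5 : cost M' π < cost M π := by
    refine Finset.sum_lt_sum (fun q _ => ?_) ⟨p, hpπ, hlt _⟩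
    by_cases h : q.1 = p.1
    · rw [h]; exact (hlt _).le
    · rw [heq _ h]
  have h6 := hπ.2 π' h1
  linarith

/-- The zeros contain an assignment as large as the optimal cover, so the optimum for `k` is zero,
while a site in row `i₀` costs something. -/
theorem notMem_participatingRows_of_le [Nonempty R] (hM : ∀ i j, 0 ≤ M i j)
    (hZ : ∀ i j, (i, j) ∈ Z → M i j = 0) {k : ℕ} (hk : k ≤ (rowMaximalOptimalCover Z).card)
    {i₀ : R} (hi₀ : ∀ j, 0 < M i₀ j)
    (hC : (rowMaximalOptimalCover Z).card ≤ Fintype.card C) : i₀ ∉ participatingRows k M := by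
  rintro ⟨π, hπ, p, hpπ, rfl⟩
  obtain ⟨π', h1, h2, -⟩ := exists_isAssignment_cost_eq (l := []) hZ trivial (by simpa using hC)
  obtain ⟨π'', h3, h4⟩ := Finset.exists_subset_card_eq (s := π') (n := k) (by
    rw [h1.1]; simpa using hk)
  have h5 := hπ.2 π'' ⟨h4, fun p hp q hq => h1.2 p (h3 hp) q (h3 hq)⟩
  have h6 : cost M π'' ≤ cost M π' :=
    Finset.sum_le_sum_of_subset_of_nonneg h3 fun _ _ _ => hM _ _
  have h7 := partialCost_greedyState_nil hZ
  have h8 : M p.1 p.2 ≤ cost M π :=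
    Finset.single_le_sum (f := fun p : R × C => M p.1 p.2) (fun _ _ => hM _ _) hpπ
  have h9 := hi₀ p.2
  linarith

end Greedy

end RowParticipation

namespace RowParticipation

/-! ### Exponential laws. -/

section Exponential

open scoped ENNReal

theorem expMeasure_eq_withDensity (r : ℝ) :
    expMeasure r = volume.withDensity (exponentialPDF r) := rfl

theorem measurable_exponentialPDF (r : ℝ) : Measurable (exponentialPDF r) :=
  (measurable_exponentialPDFReal r).ennreal_ofReal

instance nullSingletonClass_expMeasure (r : ℝ) : NullSingletonClass (expMeasure r) := by
  rw [expMeasure_eq_withDensity]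
  infer_instance

theorem expMeasure_Ioi {r a : ℝ} (hr : 0 < r) (ha : 0 ≤ a) :
    expMeasure r (Set.Ioi a) = ENNReal.ofReal (Real.exp (-(r * a))) := by
  have := isProbabilityMeasure_expMeasure hr
  have h1 : expMeasure r (Set.Iic a) = ENNReal.ofReal (1 - Real.exp (-(r * a))) := by
    rw [← ofReal_cdf, cdf_expMeasure_eq hr, if_pos ha]
  have h2 : Real.exp (-(r * a)) ≤ 1 := Real.exp_le_one_iff.2 (by nlinarith)
  rw [← Set.compl_Iic, prob_compl_eq_one_sub measurableSet_Iic, h1, ← ENNReal.ofReal_one,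
    ← ENNReal.ofReal_sub _ (by linarith)]
  congr 1
  ring

theorem setLIntegral_expMeasure {r a : ℝ} (ha : 0 ≤ a) (f : ℝ → ℝ≥0∞) (hf : Measurable f) :
    ∫⁻ t in Set.Ioi a, f t ∂expMeasure r =
      ∫⁻ t in Set.Ioi a, ENNReal.ofReal (r * Real.exp (-(r * t))) * f t := by
  rw [expMeasure_eq_withDensity,
    setLIntegral_withDensity_eq_setLIntegral_mul _ (measurable_exponentialPDF r) hf
      measurableSet_Ioi]
  refine setLIntegral_congr_fun measurableSet_Ioi fun t ht => ?_
  simp only [Pi.mul_apply]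
  rw [exponentialPDF_of_nonneg (ha.trans (le_of_lt ht))]

end Exponential

/-! ### Resampling in product measures and the law of the minimizing site. -/

section Product

open scoped ENNReal

variable {ι : Type*} [Fintype ι] (ν : ι → Measure ℝ) [∀ i, IsProbabilityMeasure (ν i)]

theorem measurable_piecewise_pair (D : Set ι) [∀ i, Decidable (i ∈ D)] :
    Measurable fun z : (ι → ℝ) × (ι → ℝ) => D.piecewise z.1 z.2 := by
  refine measurable_pi_lambda _ fun i => ?_
  by_cases h : i ∈ D
  · simp only [Set.piecewise, h, if_true]; fun_prop
  · simp only [Set.piecewise, h, if_false]; fun_prop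

/-- Resampling the coordinates outside `D` preserves a product of probability measures. -/
theorem measurePreserving_piecewise (D : Set ι) [∀ i, Decidable (i ∈ D)] :
    MeasurePreserving (fun z : (ι → ℝ) × (ι → ℝ) => D.piecewise z.1 z.2)
      ((Measure.pi ν).prod (Measure.pi ν)) (Measure.pi ν) := by
  refine ⟨measurable_piecewise_pair D, ?_⟩
  refine (Measure.pi_eq fun s hs => ?_).symm
  rw [Measure.map_apply (measurable_piecewise_pair D) (MeasurableSet.univ_pi hs)]
  have h1 : (fun z : (ι → ℝ) × (ι → ℝ) => D.piecewise z.1 z.2) ⁻¹' Set.univ.pi s =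
      (Set.univ.pi fun i => if i ∈ D then s i else Set.univ) ×ˢ
        (Set.univ.pi fun i => if i ∈ D then Set.univ else s i) := by
    ext z
    simp only [Set.mem_preimage, Set.mem_pi, Set.mem_univ, forall_true_left, Set.mem_prod,
      ← forall_and]
    refine forall_congr' fun i => ?_
    by_cases h : i ∈ D <;> simp [Set.piecewise, h]
  rw [h1, Measure.prod_prod, Measure.pi_pi, Measure.pi_pi, ← Finset.prod_mul_distrib]
  refine Finset.prod_congr rfl fun i _ => ?_
  by_cases h : i ∈ D <;> simp [h]

/-- Fubini as conditioning: `x` fixes the coordinates in `D` and `y` resamples the others. -/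
theorem pi_apply_eq_lintegral_piecewise (D : Set ι) [∀ i, Decidable (i ∈ D)] {E : Set (ι → ℝ)}
    (hE : MeasurableSet E) :
    Measure.pi ν E = ∫⁻ x, Measure.pi ν {y | D.piecewise x y ∈ E} ∂Measure.pi ν := by
  rw [← (measurePreserving_piecewise ν D).measure_preimage hE.nullMeasurableSet,
    Measure.prod_apply (measurable_piecewise_pair D hE)]
  rfl

theorem measurable_pi_piecewise (D : Set ι) [∀ i, Decidable (i ∈ D)] {E : Set (ι → ℝ)}
    (hE : MeasurableSet E) :
    Measurable fun x => Measure.pi ν {y | D.piecewise x y ∈ E} :=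
  measurable_measure_prodMk_left (measurable_piecewise_pair D hE)

theorem pi_setOf_add_eq_eq_zero {p q : ι} (hpq : p ≠ q) [NullSingletonClass (ν q)] (a : ℝ) :
    Measure.pi ν {x | x p + a = x q} = 0 := by
  classical
  have hE : MeasurableSet {x : ι → ℝ | x p + a = x q} :=
    measurableSet_eq_fun (by fun_prop) (by fun_prop)
  rw [pi_apply_eq_lintegral_piecewise ν {p} hE]
  refine (lintegral_congr fun x => ?_).trans lintegral_zero
  have h1 : {y : ι → ℝ | Set.piecewise {p} x y ∈ {x : ι → ℝ | x p + a = x q}} =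
      Function.eval q ⁻¹' ({x p + a} : Set ℝ) := by
    ext y
    simp [Set.piecewise, hpq.symm, eq_comm]
  rw [h1, (measurePreserving_eval ν q).measure_preimage (measurableSet_singleton _).nullMeasurableSet]
  exact measure_singleton _

/-- All coordinates lie in the prescribed sets, and among the coordinates in `J`, the coordinate
`p` uniquely minimizes `x q + d q`. -/
def siteEvent (J : Finset ι) (U : ι → Set ℝ) (d : ι → ℝ) (p : ι) : Set (ι → ℝ) :=
  {x | (∀ q, x q ∈ U q) ∧ ∀ q ∈ J, q ≠ p → x p + d p < x q + d q}

variable {ν} {J : Finset ι} {U : ι → Set ℝ} {d v rate : ι → ℝ}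

theorem measurableSet_siteEvent (hU : ∀ q, MeasurableSet (U q)) (p : ι) :
    MeasurableSet (siteEvent J U d p) := by
  have h : siteEvent J U d p = (⋂ q, Function.eval q ⁻¹' U q) ∩
      ⋂ q, ⋂ (_ : q ∈ J), ⋂ (_ : q ≠ p), {x | x p + d p < x q + d q} := by
    ext x; simp [siteEvent]
  rw [h]
  exact (MeasurableSet.iInter fun q => measurable_pi_apply q (hU q)).inter <|
    MeasurableSet.iInter fun q => MeasurableSet.iInter fun _ => MeasurableSet.iInter fun _ =>
      measurableSet_lt (by fun_prop) (by fun_prop)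

/-- Condition on `x p = t`. The density of `x p` contributes `rate p` and exactly the missing factor
`q = p`, as `max (v p) t = t` for `t > v p`. With the product completed to all of `J`, the integral
depends on `p` only through `d p` and `v p`. -/
theorem measure_siteEvent [DecidableEq ι] (hU : ∀ q, MeasurableSet (U q)) (hv : ∀ q, 0 ≤ v q)
    (hJ : ∀ q ∈ J, U q = Set.Ioi (v q) ∧ ν q = expMeasure (rate q) ∧ 0 < rate q) {p : ι}
    (hp : p ∈ J) :
    Measure.pi ν (siteEvent J U d p) = ENNReal.ofReal (rate p) *
      ∫⁻ t in Set.Ioi (v p), (∏ q ∈ Jᶜ, ν q (U q)) *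
        ∏ q ∈ J, ENNReal.ofReal (Real.exp (-(rate q * max (v q) (t + d p - d q)))) := by
  have hE := measurableSet_siteEvent (J := J) (d := d) hU p
  let Φ : ℝ → ℝ≥0∞ := fun t => (∏ q ∈ Jᶜ, ν q (U q)) *
        ∏ q ∈ J.erase p, ENNReal.ofReal (Real.exp (-(rate q * max (v q) (t + d p - d q))))
  have hΦ : Measurable Φ := by
    refine Measurable.const_mul (Finset.measurable_prod _ fun q _ => ?_) _
    exact ENNReal.measurable_ofReal.comp (Real.measurable_exp.comp (by fun_prop))
  have h1 : ∀ x : ι → ℝ, Measure.pi ν {y | Set.piecewise {p} x y ∈ siteEvent J U d p} =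
      (U p).indicator Φ (x p) := by
    intro x
    by_cases hx : x p ∈ U p
    · rw [Set.indicator_of_mem hx]
      have h2 : {y | Set.piecewise {p} x y ∈ siteEvent J U d p} =
          Set.univ.pi fun q => if q = p then Set.univ else
            U q ∩ {s | q ∈ J → x p + d p - d q < s} := by
        ext y
        simp only [siteEvent, Set.mem_ofPred_eq, Set.mem_pi, Set.mem_univ, forall_true_left]
        constructor
        · rintro ⟨h3, h4⟩ q
          split_ifs with hq
          · trivial
          · have := h3 q
            simp only [Set.piecewise, Set.mem_singleton_iff, hq, if_false] at this
            refine ⟨this, fun hqJ => ?_⟩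
            have := h4 q hqJ hq
            simp only [Set.piecewise, Set.mem_singleton_iff, hq, if_false, if_true] at this
            linarith
        · intro h3
          refine ⟨fun q => ?_, fun q hqJ hq => ?_⟩
          · by_cases hq : q = p
            · subst hq; simpa [Set.piecewise] using hx
            · have := h3 q
              rw [if_neg hq] at this
              simpa [Set.piecewise, hq] using this.1
          · have := h3 q
            rw [if_neg hq] at this
            have := this.2 hqJ
            simp only [Set.piecewise, Set.mem_singleton_iff, hq, if_false, if_true]
            linarith
      rw [h2, Measure.pi_pi, ← Finset.prod_compl_mul_prod J, ← Finset.mul_prod_erase J _ hp,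
        if_pos rfl, measure_univ, one_mul]
      congr 1
      · refine Finset.prod_congr rfl fun q hq => ?_
        have hqJ := Finset.mem_compl.1 hq
        rw [if_neg (by rintro rfl; exact hqJ hp)]
        congr 1
        ext s
        simp [hqJ]
      · refine Finset.prod_congr rfl fun q hq => ?_
        obtain ⟨hqp, hqJ⟩ := Finset.mem_erase.1 hq
        obtain ⟨h5, h6, h7⟩ := hJ q hqJ
        rw [if_neg hqp, h6, ← expMeasure_Ioi h7 (le_max_of_le_left (hv q)), h5]
        congr 1
        ext s
        simp [hqJ]
    · rw [Set.indicator_of_notMem hx]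
      convert measure_empty (μ := Measure.pi ν)
      rw [Set.eq_empty_iff_forall_notMem]
      rintro y ⟨h3, -⟩
      refine hx ?_
      simpa [Set.piecewise] using h3 p
  rw [pi_apply_eq_lintegral_piecewise ν {p} hE, lintegral_congr h1,
    (measurePreserving_eval ν p).lintegral_comp (hΦ.indicator (hU p)),
    lintegral_indicator (hU p)]
  obtain ⟨h5, h6, h7⟩ := hJ p hp
  rw [h5, h6, setLIntegral_expMeasure (hv p) _ hΦ, ← lintegral_const_mul]
  · refine setLIntegral_congr_fun measurableSet_Ioi fun t ht => ?_
    simp only [Φ]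
    rw [← Finset.mul_prod_erase J _ hp, ENNReal.ofReal_mul h7.le, add_sub_cancel_right,
      max_eq_right (le_of_lt ht)]
    ring
  · refine Measurable.const_mul (Finset.measurable_prod _ fun q _ => ?_) _
    exact ENNReal.measurable_ofReal.comp (Real.measurable_exp.comp (by fun_prop))

/-- There is almost surely a unique minimizer. -/
theorem measure_le_sum_siteEvent (hJ : ∀ q ∈ J, NullSingletonClass (ν q)) (hne : J.Nonempty) :
    Measure.pi ν {x | ∀ q, x q ∈ U q} ≤ ∑ p ∈ J, Measure.pi ν (siteEvent J U d p) := by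
  classical
  have h1 : {x : ι → ℝ | ∀ q, x q ∈ U q} ⊆ (⋃ p ∈ J, siteEvent J U d p) ∪
      ⋃ p ∈ J, ⋃ q ∈ J.erase p, {x | x p + (d p - d q) = x q} := by
    intro x hx
    obtain ⟨p, hp, hmin⟩ := Finset.exists_min_image J (fun q => x q + d q) hne
    by_cases h : ∃ q ∈ J.erase p, x p + (d p - d q) = x q
    · obtain ⟨q, hq, h⟩ := h
      exact Or.inr (Set.mem_biUnion hp (Set.mem_biUnion hq h))
    · push Not at h
      refine Or.inl (Set.mem_biUnion hp ⟨hx, fun q hq hqp => ?_⟩)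
      refine lt_of_le_of_ne (hmin q hq) fun heq => h q (Finset.mem_erase.2 ⟨hqp, hq⟩) ?_
      linarith
  refine (measure_mono h1).trans ((measure_union_le _ _).trans ?_)
  have h2 : Measure.pi ν (⋃ p ∈ J, ⋃ q ∈ J.erase p, {x | x p + (d p - d q) = x q}) = 0 := by
    refine (measure_biUnion_null_iff J.countable_toSet).2 fun p _ =>
      (measure_biUnion_null_iff (J.erase p).countable_toSet).2 fun q hq => ?_
    have hq' := Finset.mem_erase.1 hq
    have := hJ q hq'.2
    exact pi_setOf_add_eq_eq_zero ν hq'.1.symm _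
  rw [h2, add_zero]
  exact measure_biUnion_finset_le _ _

end Product

/-! ### Proportional hazards for the rows. -/

section Rows

open scoped ENNReal

variable {R C : Type*}

/-- All entries lie in the prescribed sets, and among the entries in the rows outside `A` and the
columns in `J`, the minimum of `x (r, j) + d j` is attained in row `i` only. -/
def rowEvent (A : Finset R) (J : Finset C) (U : R × C → Set ℝ) (d : C → ℝ) (i : R) :
    Set (R × C → ℝ) :=
  {x | (∀ q, x q ∈ U q) ∧ ∃ j ∈ J, ∀ i' ∉ A, i' ≠ i → ∀ j' ∈ J, x (i, j) + d j < x (i', j') + d j'}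

theorem disjoint_rowEvent {A : Finset R} {J : Finset C} {U : R × C → Set ℝ} {d : C → ℝ} {i i' : R}
    (hi : i ∉ A) (hi' : i' ∉ A) (hii' : i ≠ i') :
    Disjoint (rowEvent A J U d i) (rowEvent A J U d i') := by
  rw [Set.disjoint_left]
  rintro x ⟨-, j, hj, h⟩ ⟨-, j', hj', h'⟩
  have h1 := h i' hi' hii'.symm j' hj'
  have h2 := h' i hi hii' j hj
  linarith

variable [Fintype R] [Fintype C]

theorem measurableSet_rowEvent {A : Finset R} {J : Finset C} {U : R × C → Set ℝ} {d : C → ℝ}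
    (hU : ∀ q, MeasurableSet (U q)) (i : R) : MeasurableSet (rowEvent A J U d i) := by
  have h : rowEvent A J U d i = (⋂ q, Function.eval q ⁻¹' U q) ∩ ⋃ j ∈ J, ⋂ i', ⋂ (_ : i' ∉ A),
      ⋂ (_ : i' ≠ i), ⋂ j' ∈ J, {x | x (i, j) + d j < x (i', j') + d j'} := by
    ext x; simp [rowEvent]
  rw [h]
  exact (MeasurableSet.iInter fun q => measurable_pi_apply q (hU q)).inter <|
    MeasurableSet.biUnion J.countable_toSet fun j _ => MeasurableSet.iInter fun i' =>
      MeasurableSet.iInter fun _ => MeasurableSet.iInter fun _ => MeasurableSet.iInter fun j' =>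
      MeasurableSet.iInter fun _ => measurableSet_lt (by fun_prop) (by fun_prop)

/-- Proportional hazards: conditionally on lower bounds for the entries that depend on the column
only, the row of the minimum is distributed proportionally to the row weights. -/
theorem measure_rowEvent_mul [DecidableEq R] [DecidableEq C] {ν : R × C → Measure ℝ}
    [∀ q, IsProbabilityMeasure (ν q)]
    {A : Finset R} {J : Finset C} {U : R × C → Set ℝ} {d v : C → ℝ} {w : R → ℝ} {b : C → ℝ}
    (hw : ∀ i, 0 < w i) (hb : ∀ j, 0 < b j) (hU : ∀ q, MeasurableSet (U q)) (hv : ∀ j, 0 ≤ v j)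
    (hJ : ∀ i ∉ A, ∀ j ∈ J, U (i, j) = Set.Ioi (v j) ∧ ν (i, j) = expMeasure (w i * b j))
    (hJne : J.Nonempty) {i : R} (hi : i ∉ A) :
    Measure.pi ν (rowEvent A J U d i) * ∑ r ∈ Aᶜ, ENNReal.ofReal (w r) =
      ENNReal.ofReal (w i) * Measure.pi ν {x | ∀ q, x q ∈ U q} := by
  set μ := Measure.pi ν with hμ
  let K := Aᶜ ×ˢ J
  let d' : R × C → ℝ := fun q => d q.2
  have hK : ∀ q ∈ K, U q = Set.Ioi (v q.2) ∧ ν q = expMeasure (w q.1 * b q.2) ∧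
      0 < w q.1 * b q.2 := by
    intro q hq
    obtain ⟨h1, h2⟩ := Finset.mem_product.1 hq
    have h3 := hJ q.1 (Finset.mem_compl.1 h1) q.2 h2
    exact ⟨h3.1, h3.2, mul_pos (hw _) (hb _)⟩
  -- The factor of the site probability that is left after removing `w r`: bounds and offsets do not
  -- see the row, so it depends on `j` alone.
  let β : C → ℝ≥0∞ := fun j => ENNReal.ofReal (b j) *
    ∫⁻ t in Set.Ioi (v j), (∏ q ∈ Kᶜ, ν q (U q)) *
        ∏ q ∈ K, ENNReal.ofReal (Real.exp (-(w q.1 * b q.2 * max (v q.2) (t + d j - d q.2))))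
  have hsite : ∀ r ∉ A, ∀ j ∈ J, μ (siteEvent K U d' (r, j)) = ENNReal.ofReal (w r) * β j := by
    intro r hr j hj
    have h1 : (r, j) ∈ K := Finset.mem_product.2 ⟨Finset.mem_compl.2 hr, hj⟩
    rw [hμ, measure_siteEvent (v := fun q => v q.2) (rate := fun q => w q.1 * b q.2) hU
      (fun q => hv q.2) hK h1, ENNReal.ofReal_mul (hw r).le, mul_assoc]
  set Γ := ∑ j ∈ J, β j
  set T := μ {x | ∀ q, x q ∈ U q}
  -- A sandwich: the site events exhaust the total event up to ties, the row events contain them,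
  -- and the row events are disjoint inside the total event. So `hTle`, `hrow` and `hsum` are all
  -- equalities.
  have hTle : T ≤ ∑ r ∈ Aᶜ, ENNReal.ofReal (w r) * Γ := by
    refine (measure_le_sum_siteEvent (J := K) (d := d') (fun q hq => ?_)
      (Finset.Nonempty.product ⟨i, Finset.mem_compl.2 hi⟩ hJne)).trans (le_of_eq ?_)
    · rw [(hK q hq).2.1]; infer_instance
    · rw [Finset.sum_product]
      refine Finset.sum_congr rfl fun r hr => ?_
      rw [Finset.mul_sum]
      exact Finset.sum_congr rfl fun j hj => hsite r (Finset.mem_compl.1 hr) j hj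
  have hrow : ∀ r ∈ Aᶜ, ENNReal.ofReal (w r) * Γ ≤ μ (rowEvent A J U d r) := by
    intro r hr
    have hr' := Finset.mem_compl.1 hr
    have h1 : ∑ j ∈ J, μ (siteEvent K U d' (r, j)) = ENNReal.ofReal (w r) * Γ := by
      rw [Finset.mul_sum]
      exact Finset.sum_congr rfl fun j hj => hsite r hr' j hj
    rw [← h1, ← measure_biUnion_finset]
    · refine measure_mono (Set.iUnion₂_subset fun j hj x hx => ⟨hx.1, j, hj, ?_⟩)
      intro i' hi' hne j' hj'
      exact hx.2 (i', j') (Finset.mem_product.2 ⟨Finset.mem_compl.2 hi', hj'⟩)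
        fun h => hne (Prod.ext_iff.1 h).1
    · intro j hj j' hj' hne
      refine Set.disjoint_left.2 fun x hx hx' => ?_
      have h2 := hx.2 (r, j') (Finset.mem_product.2 ⟨hr, hj'⟩) fun h => hne (Prod.ext_iff.1 h).2.symm
      have h3 := hx'.2 (r, j) (Finset.mem_product.2 ⟨hr, hj⟩) fun h => hne (Prod.ext_iff.1 h).2
      linarith
    · exact fun j _ => measurableSet_siteEvent hU _
  have hsum : ∑ r ∈ Aᶜ, μ (rowEvent A J U d r) ≤ T := by
    rw [← measure_biUnion_finset]
    · exact measure_mono (Set.iUnion₂_subset fun r _ x hx => hx.1)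
    · exact fun r hr r' hr' hne =>
        disjoint_rowEvent (Finset.mem_compl.1 hr) (Finset.mem_compl.1 hr') hne
    · exact fun r _ => measurableSet_rowEvent hU _
  have hi' : i ∈ Aᶜ := Finset.mem_compl.2 hi
  have h1 : T = ∑ r ∈ Aᶜ, ENNReal.ofReal (w r) * Γ :=
    le_antisymm hTle ((Finset.sum_le_sum hrow).trans hsum)
  have h2 : μ (rowEvent A J U d i) = ENNReal.ofReal (w i) * Γ := by
    refine le_antisymm ?_ (hrow i hi')
    have h3 := hsum.trans hTle
    rw [← Finset.add_sum_erase _ _ hi', ← Finset.add_sum_erase _ _ hi'] at h3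
    have h4 : ∑ r ∈ Aᶜ.erase i, ENNReal.ofReal (w r) * Γ ≤
        ∑ r ∈ Aᶜ.erase i, μ (rowEvent A J U d r) :=
      Finset.sum_le_sum fun r hr => hrow r (Finset.mem_of_mem_erase hr)
    have h5 : ∑ r ∈ Aᶜ.erase i, μ (rowEvent A J U d r) ≠ ∞ :=
      (ENNReal.sum_lt_top.2 fun r _ => measure_lt_top _ _).ne
    exact (ENNReal.add_le_add_iff_right h5).1 (h3.trans (add_le_add le_rfl h4))
  rw [h1, h2, ← Finset.sum_mul]
  ring

end Rows

end RowParticipation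

namespace RowParticipation

/-! ### Random selection along the states. -/

section Selection

open scoped ENNReal

variable {R C K : Type*} [Fintype R] [Fintype C] [Fintype K] [DecidableEq R]

/-- A selection of rows from random entries `x (i, j)`: in the state reached by the list `l`, the
row chosen next minimizes `x (i, j) + offset l x j` over the rows outside the state and the columns
in `cols l`. -/
structure SelectionRule (Z : Set (R × C)) (K : Type*) where
  /-- The columns that are compared after the choices in a list. -/
  cols : List R → Finset K
  /-- The terms added to the entries in a column after the choices in a list. -/
  offset : List R → (R × K → ℝ) → K → ℝ
  /-- The range of an entry. -/
  range : R × K → Set ℝ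
  /-- The sites of random entries. -/
  sites : Set (R × K)
  measurable_offset : ∀ l j, Measurable fun x => offset l x j
  measurableSet_range : ∀ q, MeasurableSet (range q)
  range_eq : ∀ q ∈ sites, range q = Set.Ioi 0
  offset_congr : ∀ l x y, (∀ q : R × K, q.1 ∈ (greedyState Z l).1 → x q = y q) →
    offset l x = offset l y
  mem_sites : ∀ l, ∀ i ∉ (greedyState Z l).1, ∀ j ∈ cols l, (i, j) ∈ sites

namespace SelectionRule

variable {Z : Set (R × C)}

/-- The event that the selection starts with the rows in a list (last choice first). -/
def event (Q : SelectionRule Z K) : List R → Set (R × K → ℝ)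
  | [] => {x | ∀ q, x q ∈ Q.range q}
  | i :: l => {x | x ∈ Q.event l ∧ ∃ j ∈ Q.cols l, ∀ i' ∉ (greedyState Z l).1, i' ≠ i →
      ∀ j' ∈ Q.cols l, x (i, j) + Q.offset l x j < x (i', j') + Q.offset l x j'}

variable (Q : SelectionRule Z K)

theorem event_cons_subset (i : R) (l : List R) : Q.event (i :: l) ⊆ Q.event l := fun _ hx => hx.1

theorem event_subset_nil (l : List R) : Q.event l ⊆ Q.event [] := by
  induction l with
  | nil => exact subset_rfl
  | cons i l ih => exact (Q.event_cons_subset i l).trans ih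

theorem measurableSet_event (l : List R) : MeasurableSet (Q.event l) := by
  induction l with
  | nil =>
    have h : Q.event [] = ⋂ q, Function.eval q ⁻¹' Q.range q := by ext x; simp [event]
    rw [h]
    exact MeasurableSet.iInter fun q => measurable_pi_apply q (Q.measurableSet_range q)
  | cons i l ih =>
    have h : Q.event (i :: l) = Q.event l ∩ ⋃ j ∈ Q.cols l, ⋂ i', ⋂ (_ : i' ∉ (greedyState Z l).1),
        ⋂ (_ : i' ≠ i), ⋂ j' ∈ Q.cols l,
          {x | x (i, j) + Q.offset l x j < x (i', j') + Q.offset l x j'} := by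
      ext x; simp [event]
    rw [h]
    exact ih.inter <| MeasurableSet.biUnion (Q.cols l).countable_toSet fun j _ =>
      MeasurableSet.iInter fun i' => MeasurableSet.iInter fun _ => MeasurableSet.iInter fun _ =>
      MeasurableSet.iInter fun j' => MeasurableSet.iInter fun _ => measurableSet_lt
        ((measurable_pi_apply _).add (Q.measurable_offset l j))
        ((measurable_pi_apply _).add (Q.measurable_offset l j'))

theorem disjoint_event {i i' : R} {l : List R} (hi : i ∉ (greedyState Z l).1)
    (hi' : i' ∉ (greedyState Z l).1) (hii' : i ≠ i') :
    Disjoint (Q.event (i :: l)) (Q.event (i' :: l)) := by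
  rw [Set.disjoint_left]
  rintro x ⟨-, j, hj, h⟩ ⟨-, j', hj', h'⟩
  have h1 := h i' hi' hii'.symm j' hj'
  have h2 := h' i hi hii' j hj
  linarith

/-- Given the entries in the rows of a state, the event of reaching that state consists of lower
bounds for the other entries, which depend on the column only. -/
theorem event_eq_of_agree (l : List R) (x : R × K → ℝ) :
    (∀ y, (∀ q : R × K, q.1 ∈ (greedyState Z l).1 → y q = x q) → y ∉ Q.event l) ∨
    ∃ v : K → ℝ, (∀ j, 0 ≤ v j) ∧ ∀ y, (∀ q : R × K, q.1 ∈ (greedyState Z l).1 → y q = x q) →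
      (y ∈ Q.event l ↔ ∀ q : R × K, q.1 ∉ (greedyState Z l).1 →
        y q ∈ Q.range q ∧ (q ∈ Q.sites → v q.2 < y q)) := by
  classical
  induction l with
  | nil =>
    by_cases h : ∀ q : R × K, q.1 ∈ (greedyState Z []).1 → x q ∈ Q.range q
    · refine Or.inr ⟨fun _ => 0, fun _ => le_rfl, fun y hy => ⟨fun h1 q _ => ⟨h1 q, fun hq => ?_⟩,
        fun h1 q => ?_⟩⟩
      · have := h1 q
        rw [Q.range_eq q hq] at this
        exact this
      · by_cases hq : q.1 ∈ (greedyState Z []).1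
        · rw [hy q hq]; exact h q hq
        · exact (h1 q hq).1
    · push Not at h
      obtain ⟨q, hq, hqx⟩ := h
      exact Or.inl fun y hy h1 => hqx (hy q hq ▸ h1 q)
  | cons i l ih =>
    have hsub : insert i (greedyState Z l).1 ⊆ (greedyState Z (i :: l)).1 :=
      insert_subset_greedyState Z i l
    have hi : i ∈ (greedyState Z (i :: l)).1 := hsub (Finset.mem_insert_self _ _)
    have hsub' : (greedyState Z l).1 ⊆ (greedyState Z (i :: l)).1 :=
      (Finset.subset_insert _ _).trans hsub
    set S := (greedyState Z l).1 with hS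
    set S' := (greedyState Z (i :: l)).1 with hS'
    rcases ih with h | ⟨v, hv, h⟩
    · exact Or.inl fun y hy h1 => h y (fun q hq => hy q (hsub' hq)) h1.1
    by_cases hne : (Q.cols l).Nonempty
    swap
    · refine Or.inl fun y hy h1 => ?_
      obtain ⟨j, hj, -⟩ := h1.2
      exact hne ⟨j, hj⟩
    obtain ⟨j, hj, hmin⟩ := Finset.exists_min_image (Q.cols l)
      (fun j => x (i, j) + Q.offset l x j) hne
    -- With the entries in the rows of `S'` known, the last choice says that each other compared
    -- entry exceeds `m` minus the offset of its column, a bound that does not depend on the row.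
    set m := x (i, j) + Q.offset l x j with hm
    have hev : ∀ y, (∀ q : R × K, q.1 ∈ S' → y q = x q) → (y ∈ Q.event (i :: l) ↔
        (∀ q : R × K, q.1 ∉ S → y q ∈ Q.range q ∧ (q ∈ Q.sites → v q.2 < y q)) ∧
        ∀ i' ∉ S, i' ≠ i → ∀ j' ∈ Q.cols l, m < y (i', j') + Q.offset l x j') := by
      intro y hy
      have hoff : Q.offset l y = Q.offset l x :=
        Q.offset_congr l y x fun q hq => hy q (hsub' hq)
      rw [← h y fun q hq => hy q (hsub' hq)]
      simp only [event, Set.mem_ofPred_eq, hoff]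
      refine and_congr_right fun _ => ⟨?_, fun h2 => ⟨j, hj, ?_⟩⟩
      · rintro ⟨j₁, hj₁, h2⟩ i' hi' hne' j' hj'
        have h3 := h2 i' hi' hne' j' hj'
        rw [hy (i, j₁) hi] at h3
        exact lt_of_le_of_lt (hmin j₁ hj₁) h3
      · rw [hy (i, j) hi]
        exact h2
    -- Rows of `S'` outside `S` have known entries, so their conditions hold for all `y` under
    -- consideration or for none.
    by_cases hin : (∀ q : R × K, q.1 ∉ S → q.1 ∈ S' →
        x q ∈ Q.range q ∧ (q ∈ Q.sites → v q.2 < x q)) ∧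
        ∀ i' ∉ S, i' ≠ i → i' ∈ S' → ∀ j' ∈ Q.cols l, m < x (i', j') + Q.offset l x j'
    · refine Or.inr ⟨fun j' => if j' ∈ Q.cols l then max (v j') (m - Q.offset l x j') else v j',
        fun j' => ?_, fun y hy => ?_⟩
      · dsimp only
        split_ifs
        · exact le_max_of_le_left (hv j')
        · exact hv j'
      rw [hev y hy]
      constructor
      · rintro ⟨h1, h2⟩ q hq
        have h3 := h1 q fun hqS => hq (hsub' hqS)
        refine ⟨h3.1, fun hqs => ?_⟩
        dsimp only
        split_ifs with hqc
        · refine max_lt (h3.2 hqs) ?_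
          have := h2 q.1 (fun hqS => hq (hsub' hqS)) (by rintro h; exact hq (h ▸ hi)) q.2 hqc
          linarith
        · exact h3.2 hqs
      · intro h1
        have h2 : ∀ q : R × K, q.1 ∉ S' → q ∈ Q.sites → v q.2 < y q ∧
            (q.2 ∈ Q.cols l → m < y q + Q.offset l x q.2) := by
          intro q hq hqs
          have h3 := (h1 q hq).2 hqs
          dsimp only at h3
          split_ifs at h3 with hqc
          · have := max_lt_iff.1 h3
            exact ⟨this.1, fun _ => by linarith [this.2]⟩
          · exact ⟨h3, fun h => absurd h hqc⟩
        refine ⟨fun q hq => ?_, fun i' hi' hne' j' hj' => ?_⟩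
        · by_cases hq' : q.1 ∈ S'
          · rw [hy q hq']
            exact hin.1 q hq hq'
          · exact ⟨(h1 q hq').1, fun hqs => (h2 q hq' hqs).1⟩
        · by_cases hq' : i' ∈ S'
          · rw [hy (i', j') hq']
            exact hin.2 i' hi' hne' hq' j' hj'
          · exact (h2 (i', j') hq' (Q.mem_sites l i' hi' j' hj')).2 hj'
    · refine Or.inl fun y hy h1 => hin ?_
      rw [hev y hy] at h1
      refine ⟨fun q hq hq' => ?_, fun i' hi' hne' hq' j' hj' => ?_⟩
      · rw [← hy q hq']; exact h1.1 q hq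
      · rw [← hy (i', j') hq']; exact h1.2 i' hi' hne' j' hj'

variable {ν : R × K → Measure ℝ} [∀ q, IsProbabilityMeasure (ν q)] {w : R → ℝ} {b : K → ℝ}

/-- The next row is chosen with probability proportional to its weight. -/
theorem measure_event_cons (hw : ∀ i, 0 < w i) (hb : ∀ j, 0 < b j)
    (hν : ∀ q ∈ Q.sites, ν q = expMeasure (w q.1 * b q.2)) {i : R} {l : List R}
    (hi : i ∉ (greedyState Z l).1) (hne : (Q.cols l).Nonempty) :
    Measure.pi ν (Q.event (i :: l)) * ∑ r ∈ ((greedyState Z l).1)ᶜ, ENNReal.ofReal (w r) =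
      ENNReal.ofReal (w i) * Measure.pi ν (Q.event l) := by
  classical
  -- Fix the entries in the rows of the state and resample the rest. By `event_eq_of_agree` the past
  -- choices become lower bounds constant along columns, the setting of `measure_rowEvent_mul`.
  let D : Set (R × K) := {q | q.1 ∈ (greedyState Z l).1}
  have hm := measurable_pi_piecewise ν D (Q.measurableSet_event (i :: l))
  have hm' := measurable_pi_piecewise ν D (Q.measurableSet_event l)
  rw [pi_apply_eq_lintegral_piecewise ν D (Q.measurableSet_event (i :: l)),
    pi_apply_eq_lintegral_piecewise ν D (Q.measurableSet_event l),
    ← lintegral_mul_const _ hm, ← lintegral_const_mul _ hm']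
  refine lintegral_congr fun x => ?_
  have hag : ∀ y : R × K → ℝ, ∀ q : R × K, q.1 ∈ (greedyState Z l).1 → D.piecewise x y q = x q :=
    fun y q hq => Set.piecewise_eq_of_mem D x y hq
  have hoff : ∀ y : R × K → ℝ, Q.offset l (D.piecewise x y) = Q.offset l x :=
    fun y => Q.offset_congr l _ _ (hag y)
  have hnot : ∀ y : R × K → ℝ, ∀ q : R × K, q.1 ∉ (greedyState Z l).1 → D.piecewise x y q = y q :=
    fun y q hq => Set.piecewise_eq_of_notMem D x y hq
  rcases Q.event_eq_of_agree l x with h | ⟨v, hv, h⟩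
  · have h1 : {y | D.piecewise x y ∈ Q.event l} = ∅ :=
      Set.eq_empty_iff_forall_notMem.2 fun y hy => h _ (hag y) hy
    have h2 : {y | D.piecewise x y ∈ Q.event (i :: l)} = ∅ :=
      Set.eq_empty_iff_forall_notMem.2 fun y hy => h _ (hag y) hy.1
    rw [h1, h2, measure_empty, zero_mul, mul_zero]
  let U : R × K → Set ℝ := fun q => if q.1 ∈ (greedyState Z l).1 then Set.univ else
    if q ∈ Q.sites then Q.range q ∩ Set.Ioi (v q.2) else Q.range q
  have hUm : ∀ q, MeasurableSet (U q) := by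
    intro q
    simp only [U]
    split_ifs
    · exact MeasurableSet.univ
    · exact (Q.measurableSet_range q).inter measurableSet_Ioi
    · exact Q.measurableSet_range q
  have h0 : ∀ y, D.piecewise x y ∈ Q.event l ↔ ∀ q, y q ∈ U q := by
    intro y
    rw [h _ (hag y)]
    refine forall_congr' fun q => ?_
    by_cases hq : q.1 ∈ (greedyState Z l).1
    · simp [U, hq]
    · by_cases hq' : q ∈ Q.sites <;> simp [U, hq, hq', hnot y q hq]
  have h1 : {y | D.piecewise x y ∈ Q.event l} = {y | ∀ q, y q ∈ U q} := Set.ext h0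
  have h2 : {y | D.piecewise x y ∈ Q.event (i :: l)} =
      rowEvent (greedyState Z l).1 (Q.cols l) U (Q.offset l x) i := by
    ext y
    simp only [event, rowEvent, Set.mem_ofPred_eq, hoff, h0]
    refine and_congr_right fun _ => exists_congr fun j => and_congr_right fun _ =>
      forall_congr' fun i' => forall_congr' fun hi' => forall_congr' fun _ =>
      forall_congr' fun j' => forall_congr' fun _ => ?_
    rw [hnot y (i, j) hi, hnot y (i', j') hi']
  rw [h1, h2]
  refine measure_rowEvent_mul hw hb hUm hv (fun r hr j hj => ?_) hne hi
  have hs := Q.mem_sites l r hr j hj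
  refine ⟨?_, hν _ hs⟩
  simp only [U, if_neg hr, if_pos hs, Q.range_eq _ hs]
  exact Set.inter_eq_right.2 (Set.Ioi_subset_Ioi (hv j))

end SelectionRule

/-- The probability that `i₀` is in the list after `n` further weighted choices. -/
noncomputable def selectionProb (Z : Set (R × C)) (w : R → ℝ) (i₀ : R) : ℕ → List R → ℝ≥0∞
  | 0, l => if i₀ ∈ l then 1 else 0
  | n + 1, l => ∑ i ∈ ((greedyState Z l).1)ᶜ, ENNReal.ofReal (w i) /
      (∑ r ∈ ((greedyState Z l).1)ᶜ, ENNReal.ofReal (w r)) * selectionProb Z w i₀ n (i :: l)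

namespace SelectionRule

variable {Z : Set (R × C)} (Q : SelectionRule Z K)
variable {ν : R × K → Measure ℝ} [∀ q, IsProbabilityMeasure (ν q)] {w : R → ℝ} {b : K → ℝ}

/-- An event that is decided by the first `N` choices through the presence of `i₀`. -/
theorem measure_inter_event (hw : ∀ i, 0 < w i) (hb : ∀ j, 0 < b j)
    (hν : ∀ q ∈ Q.sites, ν q = expMeasure (w q.1 * b q.2)) {N : ℕ} {i₀ : R}
    (hne : ∀ l, IsPath Z l → l.length < N → (Q.cols l).Nonempty ∧ (((greedyState Z l).1)ᶜ).Nonempty)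
    {V : Set (R × K → ℝ)}
    (hV : ∀ l, IsPath Z l → l.length = N → i₀ ∈ l → Q.event l ⊆ V)
    (hV' : ∀ l, IsPath Z l → l.length = N → i₀ ∉ l → Disjoint V (Q.event l))
    (n : ℕ) (l : List R) (hl : IsPath Z l) (hn : l.length + n = N) :
    Measure.pi ν (V ∩ Q.event l) = selectionProb Z w i₀ n l * Measure.pi ν (Q.event l) := by
  induction n generalizing l with
  | zero =>
    by_cases hi : i₀ ∈ l
    · rw [Set.inter_eq_right.2 (hV l hl hn hi), selectionProb, if_pos hi, one_mul]
    · rw [(hV' l hl hn hi).inter_eq, selectionProb, if_neg hi, zero_mul, measure_empty]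
  | succ n ih =>
    obtain ⟨hne1, hne2⟩ := hne l hl (by omega)
    set B := ((greedyState Z l).1)ᶜ with hB
    set W := ∑ r ∈ B, ENNReal.ofReal (w r) with hW
    have hW0 : W ≠ 0 := by
      obtain ⟨r, hr⟩ := hne2
      exact fun h0 => (ENNReal.ofReal_pos.2 (hw r)).ne' (Finset.sum_eq_zero_iff.1 h0 r hr)
    have hWt : W ≠ ∞ := (ENNReal.sum_lt_top.2 fun r _ => ENNReal.ofReal_lt_top).ne
    have hstep : ∀ i ∈ B, Measure.pi ν (Q.event (i :: l)) =
        ENNReal.ofReal (w i) / W * Measure.pi ν (Q.event l) := by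
      intro i hi
      have h1 := Q.measure_event_cons hw hb hν (Finset.mem_compl.1 hi) hne1
      rw [← hB, ← hW] at h1
      rw [ENNReal.div_eq_inv_mul, mul_assoc, ← h1, mul_comm _ W, ← mul_assoc,
        ENNReal.inv_mul_cancel hW0 hWt, one_mul]
    have hdisj : Set.PairwiseDisjoint (B : Set R) fun i => Q.event (i :: l) :=
      fun i hi i' hi' hii' =>
        Q.disjoint_event (Finset.mem_compl.1 hi) (Finset.mem_compl.1 hi') hii'
    have hmeas : ∀ i ∈ B, MeasurableSet (Q.event (i :: l)) := fun i _ => Q.measurableSet_event _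
    set E := ⋃ i ∈ B, Q.event (i :: l) with hE
    have hEl : E ⊆ Q.event l := Set.iUnion₂_subset fun i _ => Q.event_cons_subset i l
    have hEm : MeasurableSet E := B.measurableSet_biUnion hmeas
    have hμE : Measure.pi ν E = Measure.pi ν (Q.event l) := by
      rw [hE, measure_biUnion_finset hdisj hmeas, Finset.sum_congr rfl hstep, ← Finset.sum_mul]
      simp only [div_eq_mul_inv]
      rw [← Finset.sum_mul, ENNReal.mul_inv_cancel hW0 hWt, one_mul]
    have hdiff : Measure.pi ν (Q.event l \ E) = 0 := by
      rw [measure_sdiff hEl hEm.nullMeasurableSet (measure_ne_top _ _), hμE, tsub_self]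
    have h1 : Measure.pi ν (V ∩ Q.event l) = Measure.pi ν (V ∩ E) := by
      refine le_antisymm ?_ (measure_mono (Set.inter_subset_inter_right _ hEl))
      refine (measure_mono (t := (V ∩ E) ∪ (Q.event l \ E)) fun x hx => ?_).trans
        ((measure_union_le _ _).trans (by rw [hdiff, add_zero]))
      by_cases hxE : x ∈ E
      · exact Or.inl ⟨hx.1, hxE⟩
      · exact Or.inr ⟨hx.2, hxE⟩
    have h2 : Measure.pi ν (V ∩ E) = ∑ i ∈ B, Measure.pi ν (V ∩ Q.event (i :: l)) := by
      -- `V` may be non-measurable; restricting the measure to `V` still gives additivity over the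
      -- measurable events.
      have h3 := measure_biUnion_finset (μ := (Measure.pi ν).restrict V) hdisj hmeas
      rw [Measure.restrict_apply hEm, Set.inter_comm] at h3
      rw [h3]
      refine Finset.sum_congr rfl fun i hi => ?_
      rw [Measure.restrict_apply (hmeas i hi), Set.inter_comm]
    rw [h1, h2, selectionProb, Finset.sum_mul]
    refine Finset.sum_congr rfl fun i hi => ?_
    rw [ih (i :: l) ⟨Finset.mem_compl.1 hi, hl⟩ (by simp only [List.length_cons]; omega),
      hstep i hi]
    ring

/-- The right side does not involve the rule `Q`, which is how the urn and the matrix are compared.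
-/
theorem measure_eq_selectionProb (hw : ∀ i, 0 < w i) (hb : ∀ j, 0 < b j)
    (hν : ∀ q ∈ Q.sites, ν q = expMeasure (w q.1 * b q.2)) {N : ℕ} {i₀ : R}
    (hnil : Measure.pi ν (Q.event []) = 1)
    (hne : ∀ l, IsPath Z l → l.length < N → (Q.cols l).Nonempty ∧ (((greedyState Z l).1)ᶜ).Nonempty)
    {V : Set (R × K → ℝ)}
    (hV : ∀ l, IsPath Z l → l.length = N → i₀ ∈ l → Q.event l ⊆ V)
    (hV' : ∀ l, IsPath Z l → l.length = N → i₀ ∉ l → Disjoint V (Q.event l)) :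
    Measure.pi ν V = selectionProb Z w i₀ N [] := by
  have h1 := Q.measure_inter_event hw hb hν hne hV hV' N [] trivial (by simp)
  rw [hnil, mul_one] at h1
  rw [← h1]
  refine le_antisymm ?_ (measure_mono Set.inter_subset_left)
  have h2 : Measure.pi ν (Q.event [])ᶜ = 0 :=
    (prob_compl_eq_zero_iff (Q.measurableSet_event [])).2 hnil
  refine (measure_mono (t := (V ∩ Q.event []) ∪ (Q.event [])ᶜ) fun x hx => ?_).trans
    ((measure_union_le _ _).trans (by rw [h2, add_zero]))
  by_cases hxE : x ∈ Q.event []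
  · exact Or.inl ⟨hx, hxE⟩
  · exact Or.inr hxE

end SelectionRule

end Selection

end RowParticipation

namespace RowParticipation

/-! ### The urn process as a selection. -/

section UrnRule

variable {R C : Type*} [Fintype R] [Fintype C] [DecidableEq R]

/-- The urn process, in which the ball outside the current state with the smallest time is chosen. -/
def urnRule (Z : Set (R × C)) : SelectionRule Z Unit where
  cols _ := Finset.univ
  offset _ _ _ := 0
  range _ := Set.Ioi 0
  sites := Set.univ
  measurable_offset _ _ := measurable_const
  measurableSet_range _ := measurableSet_Ioi
  range_eq _ _ := rfl
  offset_congr _ _ _ _ := rfl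
  mem_sites _ _ _ _ _ := trivial

variable {Z : Set (R × C)} {x : R × Unit → ℝ}

theorem lt_of_mem_event_urnRule {i : R} {l : List R} (hx : x ∈ (urnRule Z).event (i :: l)) {i' : R}
    (hi' : i' ∉ (greedyState Z l).1) (hne : i' ≠ i) : x (i, ()) < x (i', ()) := by
  obtain ⟨-, j, -, h⟩ := hx
  simpa [urnRule] using h i' hi' hne () (Finset.mem_univ _)

theorem le_of_mem_event_urnRule {i : R} {l : List R} (hl : IsPath Z (i :: l))
    (hx : x ∈ (urnRule Z).event (i :: l)) {i' : R} (hi' : i' ∈ i :: l) :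
    x (i', ()) ≤ x (i, ()) := by
  induction l generalizing i with
  | nil => rw [List.mem_singleton.1 hi']
  | cons i₁ l ih =>
    rcases List.mem_cons.1 hi' with rfl | h
    · exact le_rfl
    · refine (ih hl.2 hx.1 h).trans (lt_of_mem_event_urnRule hx.1 (fun h => hl.1 ?_) ?_).le
      · exact insert_subset_greedyState Z i₁ l (Finset.mem_insert_of_mem h)
      · rintro rfl
        exact hl.1 (mem_greedyState_of_mem Z List.mem_cons_self)

/-- Before `i` is drawn all drawn balls lie in the state of `l`, which is a cover with `k - 1`
files. From then on all rows of the path are drawn, and covers containing them have at least `k`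
files. -/
theorem exitTime_eq_of_mem_event [Nonempty C] {k : ℕ} {i : R} {l : List R} (hl : IsPath Z (i :: l))
    (hk : (rowMaximalOptimalCover Z).card + (i :: l).length = k)
    (hx : x ∈ (urnRule Z).event (i :: l)) :
    exitTime (rowIdeal k Z) (fun r => x (r, ())) = x (i, ()) := by
  classical
  have hpos : 0 < x (i, ()) := (urnRule Z).event_subset_nil _ hx (i, ())
  have hflat := isFlat_greedyState Z l
  have hcard := card_greedyState Z l hl.2
  have h1 : {t : ℝ | 0 ≤ t ∧ urnState (fun r => x (r, ())) t ∉ rowIdeal k Z} =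
      Set.Ici (x (i, ())) := by
    ext t
    simp only [Set.mem_ofPred_eq, Set.mem_Ici]
    constructor
    · rintro ⟨-, h⟩
      by_contra! hlt
      refine h ⟨(greedyState Z l).1.disjSum (greedyState Z l).2, fun p hp => by
        simpa using hflat.cover p hp, ?_, fun r hr => ?_⟩
      · rw [Finset.card_disjSum, hcard, ← hk, List.length_cons, add_assoc]
      · by_contra h2
        have h3 : r ∉ (greedyState Z l).1 := by simpa using h2
        have h4 : x (r, ()) ≤ t := hr
        by_cases hri : r = i
        · subst hri; linarith
        · have := lt_of_mem_event_urnRule hx h3 hri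
          linarith
    · intro ht
      refine ⟨hpos.le.trans ht, ?_⟩
      rintro ⟨F, hF, hFk, hsub⟩
      have := card_greedyState_le_card Z hl hF fun r hr =>
        hsub r ((le_of_mem_event_urnRule hl hx hr).trans ht)
      omega
  rw [exitTime, h1, csInf_Ici]

theorem mem_exitSet_iff_of_mem_event [Nonempty C] {k : ℕ} {i i₀ : R} {l : List R}
    (hi₀ : ∀ j, (i₀, j) ∉ Z) (hl : IsPath Z (i :: l))
    (hk : (rowMaximalOptimalCover Z).card + (i :: l).length = k)
    (hx : x ∈ (urnRule Z).event (i :: l)) :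
    i₀ ∈ exitSet (rowIdeal k Z) (fun r => x (r, ())) ↔ i₀ ∈ i :: l := by
  rw [exitSet, exitTime_eq_of_mem_event hl hk hx]
  constructor
  · intro h
    by_contra hn
    have h1 : x (i₀, ()) ≤ x (i, ()) := h
    have h2 := lt_of_mem_event_urnRule hx (i' := i₀)
      (fun h => hn (List.mem_cons_of_mem _ (mem_of_mem_greedyState Z hi₀ h)))
      (by rintro rfl; exact hn List.mem_cons_self)
    linarith
  · exact fun h => le_of_mem_event_urnRule hl hx h

/-- No cover has `k - 1` files, so the ideal is empty and the exit happens at time 0. -/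
theorem notMem_exitSet_of_le {k : ℕ} (hk : k ≤ (rowMaximalOptimalCover Z).card) {i₀ : R}
    {T : R → ℝ} (hT : 0 < T i₀) : i₀ ∉ exitSet (rowIdeal k Z) T := by
  have h1 : {t : ℝ | 0 ≤ t ∧ urnState T t ∉ rowIdeal k Z} = Set.Ici 0 := by
    ext t
    simp only [Set.mem_ofPred_eq, Set.mem_Ici, and_iff_left_iff_imp]
    rintro - ⟨F, hF, hFk, -⟩
    have := (rowMaximalOptimalCover_spec Z).1.2 F hF
    omega
  rw [exitSet, exitTime, h1, csInf_Ici]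
  exact not_le.2 hT

/-- The subtraction is truncated: for `k` at most the cover number no choice is made and both sides
are 0. -/
theorem urnMeasure_exitSet [Nonempty C] {w : R → ℝ} (hw : ∀ i, 0 < w i) {k : ℕ}
    (hkR : k ≤ Fintype.card R) {i₀ : R} (hi₀ : ∀ j, (i₀, j) ∉ Z) :
    urnMeasure w {T | i₀ ∈ exitSet (rowIdeal k Z) T} =
      selectionProb Z w i₀ (k - (rowMaximalOptimalCover Z).card) [] := by
  let e : R × Unit ≃ R := Equiv.prodPUnit R
  let ν : R × Unit → Measure ℝ := fun q => expMeasure (w (e q))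
  have hprob : ∀ q, IsProbabilityMeasure (ν q) := fun q => isProbabilityMeasure_expMeasure (hw _)
  have hprob' : ∀ i, IsProbabilityMeasure (expMeasure (w i)) :=
    fun i => isProbabilityMeasure_expMeasure (hw _)
  have hmp := measurePreserving_piCongrLeft (fun i => expMeasure (w i)) e
  have hpre : (MeasurableEquiv.piCongrLeft (fun _ : R => ℝ) e) ⁻¹'
      {T | i₀ ∈ exitSet (rowIdeal k Z) T} =
      {x : R × Unit → ℝ | i₀ ∈ exitSet (rowIdeal k Z) fun r => x (r, ())} := by
    ext x
    have : (MeasurableEquiv.piCongrLeft (fun _ : R => ℝ) e) x = fun r => x (r, ()) := by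
      funext r
      exact Equiv.piCongrLeft_apply_apply (fun _ : R => ℝ) e x (r, ())
    simp only [Set.mem_preimage, Set.mem_ofPred_eq, this]
  rw [urnMeasure, ← hmp.measure_preimage_equiv, hpre]
  refine (urnRule Z).measure_eq_selectionProb (ν := ν) (b := fun _ => 1) hw (fun _ => one_pos)
    (fun q _ => by rw [mul_one]; rfl) ?_ (fun l hl hlen => ⟨⟨(), Finset.mem_univ _⟩, ?_⟩) ?_ ?_
  · have h1 : (urnRule Z).event [] = Set.univ.pi fun _ => Set.Ioi 0 := by
      ext x; simp [SelectionRule.event, urnRule]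
    rw [h1, Measure.pi_pi]
    refine Finset.prod_eq_one fun q _ => ?_
    simp [ν, expMeasure_Ioi (hw _) le_rfl]
  · have := card_greedyState Z l hl
    rw [← Finset.card_pos, Finset.card_compl]
    omega
  · intro l hl hlen hi x hx
    cases l with
    | nil => simp at hi
    | cons i l => exact (mem_exitSet_iff_of_mem_event hi₀ hl (by
        simp only [List.length_cons] at hlen ⊢; omega) hx).2 hi
  · intro l hl hlen hi
    refine Set.disjoint_left.2 fun x hV hx => ?_
    cases l with
    | nil =>
      refine notMem_exitSet_of_le (Z := Z) (k := k) (i₀ := i₀) (T := fun r => x (r, ())) ?_ ?_ hV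
      · simp only [List.length_nil] at hlen
        omega
      · exact hx (i₀, ())
    | cons i l => exact hi ((mem_exitSet_iff_of_mem_event hi₀ hl (by
        simp only [List.length_cons] at hlen ⊢; omega) hx).1 hV)

end UrnRule

/-! ### The random matrix as a selection. -/

section MatrixRule

variable {R C : Type*} [Fintype R] [Fintype C] [DecidableEq R] [DecidableEq C]

theorem greedyState_nil_subset (Z : Set (R × C)) (l : List R) :
    (greedyState Z []).1 ⊆ (greedyState Z l).1 := by
  induction l with
  | nil => exact subset_rfl
  | cons i l ih =>
    exact ih.trans ((Finset.subset_insert _ _).trans (insert_subset_greedyState Z i l))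

theorem measurable_partialCost (S : Finset R) (E : Finset C) :
    Measurable fun x : R × C → ℝ => partialCost (fun i j => x (i, j)) S E := by
  unfold partialCost
  exact Measurable.iInf fun f => Finset.measurable_sum _ fun i _ => measurable_pi_apply _

open scoped Classical in
/-- The greedy selection of rows in a random matrix with zeros at `Z` and the entries `a` in the
rows of the row-maximal optimal cover. -/
noncomputable def matrixRule (Z : Set (R × C)) (a : R × C → ℝ) : SelectionRule Z C where
  cols l := ((greedyState Z l).2)ᶜ
  offset l x j :=
    partialCost (fun i j => x (i, j)) (greedyState Z l).1 (insert j (greedyState Z l).2)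
  range q := if q ∈ Z then {0} else if q.1 ∈ (greedyState Z []).1 then {a q} else Set.Ioi 0
  sites := {q | q.1 ∉ (greedyState Z []).1 ∧ q ∉ Z}
  measurable_offset _ _ := measurable_partialCost _ _
  measurableSet_range q := by
    split_ifs
    · exact measurableSet_singleton _
    · exact measurableSet_singleton _
    · exact measurableSet_Ioi
  range_eq q hq := by rw [if_neg hq.2, if_neg hq.1]
  offset_congr l x y h := by
    funext j
    exact partialCost_congr (fun i hi => funext fun j => h (i, j) hi) _
  mem_sites l i hi j hj := by
    refine ⟨fun h => hi (greedyState_nil_subset Z l h), fun h => ?_⟩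
    exact (Finset.mem_compl.1 hj) (((isFlat_greedyState Z l).cover _ h).resolve_left hi)

variable {Z : Set (R × C)} {a : R × C → ℝ} {x : R × C → ℝ}

theorem eq_zero_of_mem_event {l : List R} (hx : x ∈ (matrixRule Z a).event l) (i : R) (j : C)
    (h : (i, j) ∈ Z) : x (i, j) = 0 := by
  have := (matrixRule Z a).event_subset_nil l hx (i, j)
  simpa [matrixRule, h] using this

theorem pos_of_mem_event (ha : ∀ q, 0 < a q) {l : List R} (hx : x ∈ (matrixRule Z a).event l)
    (i : R) (j : C) (h : (i, j) ∉ Z) : 0 < x (i, j) := by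
  have h1 := (matrixRule Z a).event_subset_nil l hx (i, j)
  simp only [matrixRule, if_neg h] at h1
  split_ifs at h1
  · rw [h1]; exact ha _
  · exact h1

theorem nonneg_of_mem_event (ha : ∀ q, 0 < a q) {l : List R} (hx : x ∈ (matrixRule Z a).event l)
    (i : R) (j : C) : 0 ≤ x (i, j) := by
  by_cases h : (i, j) ∈ Z
  · exact (eq_zero_of_mem_event hx i j h).ge
  · exact (pos_of_mem_event ha hx i j h).le

theorem isGreedy_of_mem_event {l : List R} (hx : x ∈ (matrixRule Z a).event l) :
    IsGreedy Z (fun i j => x (i, j)) l := by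
  induction l with
  | nil => trivial
  | cons i l ih =>
    refine ⟨ih hx.1, ?_⟩
    obtain ⟨-, j₁, hj₁, h⟩ := hx
    simp only [matrixRule, Finset.mem_compl] at hj₁ h
    obtain ⟨j, hj, hmin⟩ := Finset.exists_min_image ((greedyState Z l).2)ᶜ (fun j => x (i, j) +
      partialCost (fun i j => x (i, j)) (greedyState Z l).1 (insert j (greedyState Z l).2))
      ⟨j₁, Finset.mem_compl.2 hj₁⟩
    refine ⟨j, Finset.mem_compl.1 hj, fun i' hi' j' hj' => ?_⟩
    by_cases hii' : i' = i
    · subst hii'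
      exact hmin j' (Finset.mem_compl.2 hj')
    · exact (hmin j₁ (Finset.mem_compl.2 hj₁)).trans (h i' hi' hii' j' hj').le

theorem mem_participatingRows_of_mem_event [Nonempty R] [Nonempty C] (ha : ∀ q, 0 < a q) {k : ℕ}
    (hkR : k ≤ Fintype.card R) (hkC : k ≤ Fintype.card C) {l : List R} (hl : IsPath Z l)
    (hk : (rowMaximalOptimalCover Z).card + l.length = k) (hx : x ∈ (matrixRule Z a).event l)
    {i : R} (hi : i ∈ l) : i ∈ participatingRows k fun i j => x (i, j) := by
  subst hk
  exact (isGreedy_of_mem_event hx).mem_participatingRows (nonneg_of_mem_event ha hx)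
    (eq_zero_of_mem_event hx) hl hkR hkC hi

/-- The entries of row `i₀` strictly exceed the bounds `v` that describe the event, so moving them
halfway down to `v` keeps all choices. `IsGreedy.notMem_participatingRows` then applies to the
lowered matrix. -/
theorem notMem_participatingRows_of_mem_event [Nonempty R] [Nonempty C] (ha : ∀ q, 0 < a q) {k : ℕ}
    (hkR : k ≤ Fintype.card R) (hkC : k ≤ Fintype.card C) {l : List R} (hl : IsPath Z l)
    (hk : (rowMaximalOptimalCover Z).card + l.length = k) (hx : x ∈ (matrixRule Z a).event l)
    {i₀ : R} (hi₀ : ∀ j, (i₀, j) ∉ Z) (hi : i₀ ∉ l) :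
    i₀ ∉ participatingRows k fun i j => x (i, j) := by
  subst hk
  have hi₀S : i₀ ∉ (greedyState Z l).1 := fun h => hi (mem_of_mem_greedyState Z hi₀ h)
  have hsite : ∀ j, (i₀, j) ∈ (matrixRule Z a).sites := fun j =>
    ⟨fun h => hi₀S (greedyState_nil_subset Z l h), hi₀ j⟩
  rcases (matrixRule Z a).event_eq_of_agree l x with h | ⟨v, hv, h⟩
  · exact absurd hx (h x fun _ _ => rfl)
  have hx' := (h x fun _ _ => rfl).1 hx
  have hlt : ∀ j, v j < x (i₀, j) := fun j => (hx' (i₀, j) hi₀S).2 (hsite j)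
  let y : R × C → ℝ := fun q => if q.1 = i₀ then (v q.2 + x q) / 2 else x q
  have hy : y ∈ (matrixRule Z a).event l := by
    refine (h y fun q hq => if_neg (by rintro h; exact hi₀S (h ▸ hq))).2 fun q hq => ?_
    by_cases hqi : q.1 = i₀
    · obtain ⟨i, j⟩ := q
      obtain rfl : i = i₀ := hqi
      simp only [y, if_true]
      have h1 := hlt j
      rw [(matrixRule Z a).range_eq _ (hsite j)]
      exact ⟨by have := hv j; rw [Set.mem_Ioi]; linarith, fun _ => by linarith⟩
    · simp only [y, if_neg hqi]
      exact hx' q hq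
  refine (isGreedy_of_mem_event hy).notMem_participatingRows hi₀ (nonneg_of_mem_event ha hy)
    (fun j => ?_) (fun i hne => ?_) (eq_zero_of_mem_event hx) hl hkR hkC hi
  · simp only [y, if_true]
    linarith [hlt j]
  · funext j
    simp only [y, if_neg hne]

theorem card_rowMaximalOptimalCover_le (Z : Set (R × C)) :
    (rowMaximalOptimalCover Z).card ≤ Fintype.card C := by
  have := (rowMaximalOptimalCover_spec Z).1.2 ((∅ : Finset R).disjSum Finset.univ)
    fun p _ => Or.inr (by simp)
  simpa using this

theorem pi_participatingRows [Nonempty R] [Nonempty C] (ha : ∀ q, 0 < a q) {w : R → ℝ} {b : C → ℝ}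
    (hw : ∀ i, 0 < w i) (hb : ∀ j, 0 < b j) {ν : R × C → Measure ℝ}
    [∀ q, IsProbabilityMeasure (ν q)]
    (hν : ∀ q, q.1 ∉ (greedyState Z []).1 → q ∉ Z → ν q = expMeasure (w q.1 * b q.2))
    (hνZ : ∀ q ∈ Z, ν q = Measure.dirac 0)
    (hνa : ∀ q ∉ Z, q.1 ∈ (greedyState Z []).1 → ν q = Measure.dirac (a q))
    {k : ℕ} (hkR : k ≤ Fintype.card R) (hkC : k ≤ Fintype.card C) {i₀ : R}
    (hi₀ : ∀ j, (i₀, j) ∉ Z) :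
    Measure.pi ν {x | i₀ ∈ participatingRows k fun i j => x (i, j)} =
      selectionProb Z w i₀ (k - (rowMaximalOptimalCover Z).card) [] := by
  refine (matrixRule Z a).measure_eq_selectionProb hw hb (fun q hq => hν q hq.1 hq.2) ?_
    (fun l hl hlen => ⟨?_, ?_⟩) ?_ ?_
  · have h1 : (matrixRule Z a).event [] = Set.univ.pi (matrixRule Z a).range := by
      ext x; simp [SelectionRule.event]
    rw [h1, Measure.pi_pi]
    refine Finset.prod_eq_one fun q _ => ?_
    simp only [matrixRule]
    split_ifs with h2 h3
    · rw [hνZ q h2, Measure.dirac_apply_of_mem (Set.mem_singleton _)]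
    · rw [hνa q h2 h3, Measure.dirac_apply_of_mem (Set.mem_singleton _)]
    · rw [hν q h3 h2, expMeasure_Ioi (mul_pos (hw _) (hb _)) le_rfl]
      simp
  · have := card_greedyState Z l hl
    simp only [matrixRule]
    rw [← Finset.card_pos, Finset.card_compl]
    omega
  · have := card_greedyState Z l hl
    rw [← Finset.card_pos, Finset.card_compl]
    omega
  · intro l hl hlen hi x hx
    have h1 : 0 < l.length := List.length_pos_of_mem hi
    exact mem_participatingRows_of_mem_event ha hkR hkC hl (by omega) hx hi
  · intro l hl hlen hi
    refine Set.disjoint_left.2 fun x hV hx => ?_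
    by_cases hk : k ≤ (rowMaximalOptimalCover Z).card
    · exact notMem_participatingRows_of_le (nonneg_of_mem_event ha hx) (eq_zero_of_mem_event hx) hk
        (fun j => pos_of_mem_event ha hx i₀ j (hi₀ j)) (card_rowMaximalOptimalCover_le Z) hV
    · exact notMem_participatingRows_of_mem_event ha hkR hkC hl (by omega) hx hi₀ hi hV

theorem measurableSet_participatingRows (k : ℕ) (i₀ : R) :
    MeasurableSet {x : R × C → ℝ | i₀ ∈ participatingRows k fun i j => x (i, j)} := by
  have h : {x : R × C → ℝ | i₀ ∈ participatingRows k fun i j => x (i, j)} =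
      ⋃ (π : Finset (R × C)) (_ : IsAssignment k π ∧ ∃ p ∈ π, p.1 = i₀),
        ⋂ (π' : Finset (R × C)) (_ : IsAssignment k π'),
          {x : R × C → ℝ | ∑ p ∈ π, x p ≤ ∑ p ∈ π', x p} := by
    ext x
    simp only [participatingRows, IsOptimalAssignment, cost, Set.mem_ofPred_eq, Set.mem_iUnion,
      Set.mem_iInter, exists_prop]
    exact exists_congr fun π => by tauto
  rw [h]
  exact MeasurableSet.iUnion fun π => MeasurableSet.iUnion fun _ => MeasurableSet.iInter fun π' =>
    MeasurableSet.iInter fun _ => measurableSet_le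
      (Finset.measurable_sum _ fun p _ => measurable_pi_apply p)
      (Finset.measurable_sum _ fun p _ => measurable_pi_apply p)

end MatrixRule

/-! ### The joint law of the entries. -/

section Law

/-- The joint law of real random variables, some of which are independent with given laws, while the
others are almost surely constant. -/
theorem map_eq_pi_of_iIndepFun {Ω ι : Type*} [Fintype ι] [MeasurableSpace Ω] {P : Measure Ω}
    [IsProbabilityMeasure P] {X : ι → Ω → ℝ} {p : ι → Prop} {ν : ι → Measure ℝ}
    [∀ i, IsProbabilityMeasure (ν i)] {a : ι → ℝ}
    (hlaw : ∀ i, p i → HasLaw (X i) (ν i) P)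
    (hconst : ∀ i, ¬ p i → (∀ᵐ ω ∂P, X i ω = a i) ∧ ν i = Measure.dirac (a i))
    (hindep : iIndepFun (fun (i : {i // p i}) (ω : Ω) => X i.1 ω) P) :
    AEMeasurable (fun ω i => X i ω) P ∧ P.map (fun ω i => X i ω) = Measure.pi ν := by
  classical
  have hX : AEMeasurable (fun ω i => X i ω) P := by
    refine aemeasurable_pi_lambda _ fun i => ?_
    by_cases hi : p i
    · exact (hlaw i hi).aemeasurable
    · exact aemeasurable_const.congr
        ((hconst i hi).1.mono fun ω h => h.symm : (fun _ => a i) =ᵐ[P] X i)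
  refine ⟨hX, (Measure.pi_eq fun s hs => ?_).symm⟩
  rw [Measure.map_apply_of_aemeasurable hX (MeasurableSet.univ_pi hs),
    ← Fintype.prod_subtype_mul_prod_subtype p]
  have hae : ∀ᵐ ω ∂P, ∀ i, ¬ p i → X i ω = a i := by
    refine ae_all_iff.2 fun i => ?_
    by_cases hi : p i
    · exact Filter.Eventually.of_forall fun ω h => absurd hi h
    · exact (hconst i hi).1.mono fun ω h _ => h
  by_cases hall : ∀ i, ¬ p i → a i ∈ s i
  · have h1 : ∏ i : {i // ¬ p i}, ν i (s i) = 1 := by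
      refine Finset.prod_eq_one fun i _ => ?_
      rw [(hconst i i.2).2, Measure.dirac_apply_of_mem (hall i i.2)]
    have h2 : (fun ω i => X i ω) ⁻¹' Set.univ.pi s =ᵐ[P]
        ⋂ i ∈ (Finset.univ : Finset {i // p i}), (fun ω => X i.1 ω) ⁻¹' s i.1 := by
      refine Filter.eventuallyEq_set.2 (hae.mono fun ω hω => ?_)
      simp only [Set.mem_preimage, Set.mem_pi, Set.mem_univ, forall_true_left, Finset.mem_univ,
        Set.mem_iInter, Subtype.forall]
      refine ⟨fun h i _ => h i, fun h i => ?_⟩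
      by_cases hi : p i
      · exact h i hi
      · rw [hω i hi]; exact hall i hi
    rw [measure_congr h2, h1, mul_one,
      iIndepFun_iff_measure_inter_preimage_eq_mul.1 hindep _ fun i _ => hs i.1]
    refine Finset.prod_congr rfl fun i _ => ?_
    rw [← (hlaw i i.2).map_eq, Measure.map_apply_of_aemeasurable (hlaw i i.2).aemeasurable (hs i)]
  · push Not at hall
    obtain ⟨i, hi, his⟩ := hall
    have h1 : ∏ i : {i // ¬ p i}, ν i (s i) = 0 := by
      refine Finset.prod_eq_zero (Finset.mem_univ ⟨i, hi⟩) ?_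
      rw [(hconst i hi).2, Measure.dirac_apply' _ (hs i), Set.indicator_of_notMem his]
    rw [h1, mul_zero]
    rw [measure_eq_zero_iff_ae_notMem]
    refine hae.mono fun ω h hω => his ?_
    rw [← h i hi]
    exact hω i (Set.mem_univ _)

end Law

end RowParticipation

/-! ### Comparison of the matrix and the urn. -/

theorem mainTheorem4 {R C Ω : Type*} [Fintype R] [Fintype C] [MeasurableSpace Ω]
    (P : Measure Ω) [IsProbabilityMeasure P]
    (wR : R → ℝ) (wC : C → ℝ) (hwR : ∀ i, 0 < wR i) (hwC : ∀ j, 0 < wC j)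
    (k : ℕ) (hk : 1 ≤ k) (hkR : k ≤ Fintype.card R) (hkC : k ≤ Fintype.card C)
    (Z : Set (R × C)) (M : Ω → Matrix R C ℝ)
    (hzero : ∀ i j, (i, j) ∈ Z → ∀ᵐ ω ∂P, M ω i j = 0)
    (hfixed : ∀ i j, i ∈ RowParticipation.rowMaximalRows Z → (i, j) ∉ Z →
      ∃ a : ℝ, 0 < a ∧ ∀ᵐ ω ∂P, M ω i j = a)
    (hexp : ∀ i j, i ∉ RowParticipation.rowMaximalRows Z → (i, j) ∉ Z →
      HasLaw (fun ω => M ω i j) (expMeasure (wR i * wC j)) P)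
    (hindep : iIndepFun
      (fun (p : {p : R × C // p.1 ∉ RowParticipation.rowMaximalRows Z ∧ p ∉ Z}) (ω : Ω) =>
        M ω p.1.1 p.1.2) P)
    (i₀ : R) (hi₀ : ∀ j, (i₀, j) ∉ Z) :
    P {ω | i₀ ∈ RowParticipation.participatingRows k (M ω)} =
      RowParticipation.urnMeasure wR
        {T | i₀ ∈ RowParticipation.exitSet (RowParticipation.rowIdeal k Z) T} := by
  classical
  open RowParticipation in
  have : Nonempty R := ⟨i₀⟩
  have : Nonempty C := Fintype.card_pos_iff.1 (by omega)
  have hrow : ∀ i, i ∈ rowMaximalRows Z ↔ i ∈ (greedyState Z []).1 := fun i => by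
    simp [rowMaximalRows, greedyState]
  have hfix : ∀ q : R × C, ∃ a : ℝ, 0 < a ∧
      (q.1 ∈ rowMaximalRows Z → q ∉ Z → ∀ᵐ ω ∂P, M ω q.1 q.2 = a) := by
    intro q
    by_cases h : q.1 ∈ rowMaximalRows Z ∧ q ∉ Z
    · obtain ⟨a, ha, h'⟩ := hfixed q.1 q.2 h.1 h.2
      exact ⟨a, ha, fun _ _ => h'⟩
    · exact ⟨1, one_pos, fun h1 h2 => absurd ⟨h1, h2⟩ h⟩
  choose a ha hMa using hfix
  let ν : R × C → Measure ℝ := fun q => if q ∈ Z then Measure.dirac 0 else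
    if q.1 ∈ rowMaximalRows Z then Measure.dirac (a q) else expMeasure (wR q.1 * wC q.2)
  have hprob : ∀ q, IsProbabilityMeasure (ν q) := by
    intro q
    simp only [ν]
    split_ifs
    · infer_instance
    · infer_instance
    · exact isProbabilityMeasure_expMeasure (mul_pos (hwR _) (hwC _))
  obtain ⟨h1, h2⟩ := map_eq_pi_of_iIndepFun (P := P) (X := fun (q : R × C) ω => M ω q.1 q.2)
    (p := fun q => q.1 ∉ rowMaximalRows Z ∧ q ∉ Z) (ν := ν)
    (a := fun q => if q ∈ Z then 0 else a q)
    (fun q hq => by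
      simp only [ν, if_neg hq.1, if_neg hq.2]
      exact hexp q.1 q.2 hq.1 hq.2)
    (fun q hq => by
      by_cases hZ : q ∈ Z
      · simp only [ν, if_pos hZ, and_true]
        exact hzero q.1 q.2 hZ
      · have hr : q.1 ∈ rowMaximalRows Z := by
          by_contra h
          exact hq ⟨h, hZ⟩
        simp only [ν, if_neg hZ, if_pos hr, and_true]
        exact hMa q hr hZ)
    hindep
  have h3 := Measure.map_apply_of_aemeasurable h1 (measurableSet_participatingRows k i₀)
  rw [h2] at h3
  rw [urnMeasure_exitSet hwR hkR hi₀, ← pi_participatingRows (a := a) ha hwR hwC (ν := ν) ?_ ?_ ?_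
    hkR hkC hi₀, h3]
  · rfl
  · intro q hq hZ
    simp only [ν, if_neg hZ, if_neg (fun h => hq ((hrow _).1 h))]
  · intro q hZ
    simp only [ν, if_pos hZ]
  · intro q hZ hq
    simp only [ν, if_neg hZ, if_pos ((hrow _).2 hq)]
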